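/- \textbf{Lemma 7 ($M$-Lipschitz continuous Hessian).} Let $A\in\mathbb R^{n\times n}$, $B\in\mathbb R^{n\times m}$, $C\in\mathbb R^{d\times n}$, let $Q\in\mathbb R^{n\times n}$ and $R\in\mathbb R^{m\times m}$ be symmetric positive definite, and let $\mathcal D$ be a probability distribution on $\mathbb R^n$ with finite second moments and $X_0:=\mathbb E_{x_0\sim\mathcal D}[x_0x_0^\top]\succ0$. For $K\in\mathbb R^{m\times d}$ put $\mathcal A_K:=A-BKC$, let $\mathbb K:=\{K:\rho(\mathcal A_K)<1\}$ be the set of stabilizing gains, and for $K\in\mathbb K$ let $$J(K):=\mathbb E_{x_0\sim\mathcal D}\Big[\sum_{t=0}^{\infty}\big(x_t^\top Qx_t+u_t^\top Ru_t\big)\Big],\qquad x_{t+1}=Ax_t+Bu_t,\quad u_t=-KCx_t .$$ For $\alpha\in\mathbb R$ let $\mathbb K_\alpha:=\{K\in\mathbb K: J(K)\le\alpha\}$. Write $\|\cdot\|$ for the induced $2$-norm, $\|\cdot\|_F$ for the Frobenius norm, $\sigma_{\min}$ for the minimal singular value, $\mu:=\sigma_{\min}(X_0)$, and let $\nabla^2J(\mathrm{vec}(K))\in\mathbb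 R^{md\times md}$ be the Hessian of $J$ as a function of the vectorized gain. Let $K,K'\in\mathbb K_\alpha$ be such that $(1-\delta)K+\delta K'\in\mathbb K_\alpha$ for every $\delta\in[0,1]$. Then the maximum $\gamma:=\max_{L\in\mathbb K_\alpha}\|\mathcal A_L\|$ exists, $J$ is twice continuously differentiable at $K$ and at $K'$, and $$\|\nabla^2J(\mathrm{vec}(K'))-\nabla^2J(\mathrm{vec}(K))\|_F\le M\,\|K'-K\|_F,$$ where $$M=\frac{4\alpha^2\sqrt{md}}{\mu\,\sigma_{\min}(Q)}\Big(\big(\zeta_1+\tfrac{\zeta_2}{2}\big)\|B\|\|C\|+\zeta_3+\tfrac{\zeta_4}{2}\Big)\|B\|\|C\|,$$ $$\zeta_1=\frac1{\sigma_{\min}(Q)}\Big(\frac\alpha\mu\big(1+\|B\|^2\|C\|^2\big)+\|R\|\|C\|^2\Big)-1,\qquad \zeta_2=\frac{2\|C\|}{\sigma_{\min}(Q)}\Big(\frac{\alpha\gamma}{\mu}\|B\|+\psi\|R\|\Big),$$ $$\zeta_3=\frac{2\|C\|}{\sigma_{\min}(Q)}\Big(\frac\alpha\mu\big(\zeta_1\gamma+\zeta_2\gamma+\|B\|\|C\|\big)\|B\|+\|R\|\|C\|\Big),\qquad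 \zeta_4=\frac{2\|C\|}{\sigma_{\min}(Q)}\Big(\frac\alpha\mu\big(\zeta_1\gamma+\|B\|\|C\|\big)\|B\|+\|R\|\|C\|\Big),$$ $$\psi=\frac{\sqrt{\|R\|\alpha+\|B\|^2\alpha^2/\mu}}{\sqrt\mu\,\sigma_{\min}(R)}+\frac{\|B\|\|A\|\alpha}{\mu\,\sigma_{\min}(R)} .$$ -/

import Mathlib

open MeasureTheory Matrix

noncomputable section

/-- The induced 2-norm (spectral norm) of a real matrix. -/
def specNorm {p q : ℕ} (M : Matrix (Fin p) (Fin q) ℝ) : ℝ :=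
  ‖(toEuclideanLin M).toContinuousLinearMap‖

/-- The Frobenius norm of a real matrix. -/
def frobNorm {ι κ : Type*} [Fintype ι] [Fintype κ] (M : Matrix ι κ ℝ) : ℝ :=
  √(∑ i, ∑ j, M i j ^ 2)

/-- The minimal singular value of a square real matrix (the singular values of an `n × n` matrix
are listed in descending order at the indices `0, …, n - 1`). -/
def sigmaMin {n : ℕ} (M : Matrix (Fin n) (Fin n) ℝ) : ℝ :=
  (toEuclideanLin M).singularValues (n - 1)

/-- The data of a static output feedback problem with state dimension `n`, input dimension `m` and
output dimension `d`: the system matrices, the cost weights and the law of the initial state. -/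
structure SOFProblem (n m d : ℕ) where
  /-- state matrix -/
  A : Matrix (Fin n) (Fin n) ℝ
  /-- input matrix -/
  B : Matrix (Fin n) (Fin m) ℝ
  /-- output matrix -/
  C : Matrix (Fin d) (Fin n) ℝ
  /-- state weight -/
  Q : Matrix (Fin n) (Fin n) ℝ
  /-- input weight -/
  R : Matrix (Fin m) (Fin m) ℝ
  /-- law of the initial state -/
  D : Measure (Fin n → ℝ)

namespace SOFProblem

variable {n m d : ℕ}

/-- The feedback input `u = -K y` with `y = C x`, at the state `x`. -/
def input (S : SOFProblem n m d) (K : Matrix (Fin m) (Fin d) ℝ) (x : Fin n → ℝ) : Fin m → ℝ :=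
  -(K *ᵥ (S.C *ᵥ x))

/-- The state trajectory `x_{t+1} = A x_t + B u_t` under the gain `K`, started at `x₀`. -/
def state (S : SOFProblem n m d) (K : Matrix (Fin m) (Fin d) ℝ) (x₀ : Fin n → ℝ) :
    ℕ → Fin n → ℝ
  | 0 => x₀
  | t + 1 => S.A *ᵥ S.state K x₀ t + S.B *ᵥ S.input K (S.state K x₀ t)

/-- The cost `xᵀ Q x + uᵀ R u` incurred at time `t`. -/
def stageCost (S : SOFProblem n m d) (K : Matrix (Fin m) (Fin d) ℝ) (x₀ : Fin n → ℝ) (t : ℕ) : ℝ :=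
  S.state K x₀ t ⬝ᵥ (S.Q *ᵥ S.state K x₀ t) +
    S.input K (S.state K x₀ t) ⬝ᵥ (S.R *ᵥ S.input K (S.state K x₀ t))

/-- The cost `J(K)`: the expected accumulated stage cost. It is used at stabilizing gains only,
where the series and the expectation are finite. -/
def cost (S : SOFProblem n m d) (K : Matrix (Fin m) (Fin d) ℝ) : ℝ :=
  ∫ x₀, ∑' t, S.stageCost K x₀ t ∂S.D

/-- The closed-loop matrix `A - B K C`. -/
def closedLoop (S : SOFProblem n m d) (K : Matrix (Fin m) (Fin d) ℝ) :
    Matrix (Fin n) (Fin n) ℝ :=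
  S.A - S.B * K * S.C

/-- The feasible set of stabilizing gains: the closed-loop matrix has spectral radius (over `ℂ`)
less than one. -/
def feasible (S : SOFProblem n m d) : Set (Matrix (Fin m) (Fin d) ℝ) :=
  {K | spectralRadius ℂ ((S.closedLoop K).map Complex.ofReal) < 1}

/-- The sublevel set of the cost. -/
def sublevel (S : SOFProblem n m d) (α : ℝ) : Set (Matrix (Fin m) (Fin d) ℝ) :=
  {K | K ∈ S.feasible ∧ S.cost K ≤ α}

/-- The initial state correlation matrix `E[x₀ x₀ᵀ]`. -/
def X0 (S : SOFProblem n m d) : Matrix (Fin n) (Fin n) ℝ :=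
  Matrix.of fun i j => ∫ x, x i * x j ∂S.D

/-- The cost as a function of the vectorized gain: `S.costVec (vec K) = S.cost K`. -/
def costVec (S : SOFProblem n m d) (v : Fin d × Fin m → ℝ) : ℝ :=
  S.cost (Matrix.of fun i j => v (j, i))

/-- The Hessian of the cost at `vec K`, the `md × md` matrix of second partial derivatives. -/
def hessian (S : SOFProblem n m d) (K : Matrix (Fin m) (Fin d) ℝ) :
    Matrix (Fin d × Fin m) (Fin d × Fin m) ℝ :=
  Matrix.of fun p q => iteratedFDeriv ℝ 2 S.costVec (vec K) ![Pi.single p 1, Pi.single q 1]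

/-- `μ = σ_min(X₀)`. -/
def mu (S : SOFProblem n m d) : ℝ := sigmaMin S.X0

/-- `γ`, the maximum of `‖A - B K C‖` over the sublevel set. -/
def gam (S : SOFProblem n m d) (α : ℝ) : ℝ :=
  sSup ((fun K => specNorm (S.closedLoop K)) '' S.sublevel α)

/-- `ψ`, the explicit upper bound of `‖K C‖` on the sublevel set. -/
def psi (S : SOFProblem n m d) (α : ℝ) : ℝ :=
  √(specNorm S.R * α + specNorm S.B ^ 2 * α ^ 2 / S.mu) / (√S.mu * sigmaMin S.R) +
    specNorm S.B * specNorm S.A * α / (S.mu * sigmaMin S.R)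

/-- The parameter `ζ₁`. -/
def zeta1 (S : SOFProblem n m d) (α : ℝ) : ℝ :=
  1 / sigmaMin S.Q *
    (α / S.mu * (1 + specNorm S.B ^ 2 * specNorm S.C ^ 2) + specNorm S.R * specNorm S.C ^ 2) - 1

/-- The parameter `ζ₂`. -/
def zeta2 (S : SOFProblem n m d) (α : ℝ) : ℝ :=
  2 * specNorm S.C / sigmaMin S.Q *
    (α * S.gam α / S.mu * specNorm S.B + S.psi α * specNorm S.R)

/-- The parameter `ζ₃`. -/
def zeta3 (S : SOFProblem n m d) (α : ℝ) : ℝ :=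
  2 * specNorm S.C / sigmaMin S.Q *
    (α / S.mu * (S.zeta1 α * S.gam α + S.zeta2 α * S.gam α + specNorm S.B * specNorm S.C) *
      specNorm S.B + specNorm S.R * specNorm S.C)

/-- The parameter `ζ₄`. -/
def zeta4 (S : SOFProblem n m d) (α : ℝ) : ℝ :=
  2 * specNorm S.C / sigmaMin S.Q *
    (α / S.mu * (S.zeta1 α * S.gam α + specNorm S.B * specNorm S.C) * specNorm S.B +
      specNorm S.R * specNorm S.C)

/-- The Lipschitz constant `M`. -/
def lipConst (S : SOFProblem n m d) (α : ℝ) : ℝ :=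
  4 * α ^ 2 * √((m : ℝ) * d) / (S.mu * sigmaMin S.Q) *
    ((S.zeta1 α + S.zeta2 α / 2) * specNorm S.B * specNorm S.C + S.zeta3 α + S.zeta4 α / 2) *
    specNorm S.B * specNorm S.C

end SOFProblem

end

/-!
The argument differentiates the Lyapunov equation of the value matrix three times and bounds the
solutions in the order of quadratic forms.

For a stabilizing gain `K` with closed loop `A = A_K`, the cost is `J(K) = tr (X₀ P)`, where the
value matrix `P` solves `P = Aᵀ P A + Q + (K C)ᵀ R (K C)`. The solution of a Lyapunov equation is a
smooth function of its data, and its derivative solves a Lyapunov equation with the same operator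
(`PowStable.hasDerivAt_lyap`). Hence the derivatives `value₁`, `value₂`, `value₃` of `P` along gain
directions are again solutions of Lyapunov equations, whose sources are explicit, and the second and
third derivatives of `J` are `tr (X₀ value₂)` and `tr (X₀ value₃)`.

On a sublevel set `P ≤ α / μ` and `σ_min(Q) W ≤ P`, where `W` solves the equation with source `1`.
A Lyapunov solution is monotone in its source, so bounds of the sources give bounds of the
derivatives: a source bounded by `a |x|² + 2 b |x| |A x|` has a solution bounded by `(a + 2 b) W`
(`PowStable.abs_lyap_le_mul_lyap_one`), in which the factor `‖A‖` of the cross term is absent. With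
`β = ‖B‖ ‖C‖` and `p = α / μ` this bounds `value₁` by `ζ p`, where `ζ` is `valueRate`, and
`value₂` by `valueRate₂`, and it bounds the third derivative of `J` by
`(6 β² ζ p + 6 β valueRate₂) α / σ_min(Q)`; see `abs_traceX0_value₃_le`.

To reach the constant `M` one needs both `ζ ≤ ζ₁` and `3 ζ / 2 ≤ ζ₂`, the factor `3 / 2` because the
bound of `value₂` along two equal directions has a cross term with `2 ζ`, while `ζ₄` contains only
`ζ₁`. The first inequality is Young's inequality for the source of `value₁`. The second one
(`valueRate_le_zeta2`) rests on `ψ ‖R‖ ≥ √(‖R‖ p + ‖B‖² p²)`, so that `ζ₂` exceeds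
`2 p β γ / σ_min(Q)` by enough.

The Hessian bound follows by the mean value inequality along the segment, tested on each column of
the difference of the Hessians. The maximum `γ` exists because the pairs `(K C, P)` over the
sublevel set form a compact set: by Lyapunov's theorem they are cut out by closed conditions
(`mem_certificates_iff`), although the gains themselves may be unbounded.
-/

noncomputable section

/-! ### Euclidean norms, quadratic forms and singular values -/

/-- The Euclidean norm of a coordinate vector. -/
def vnorm {k : ℕ} (x : Fin k → ℝ) : ℝ := ‖WithLp.toLp 2 x‖

theorem vnorm_nonneg {k : ℕ} (x : Fin k → ℝ) : 0 ≤ vnorm x := norm_nonneg _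

theorem vnorm_zero {k : ℕ} : vnorm (0 : Fin k → ℝ) = 0 := by
  rw [vnorm, WithLp.toLp_zero, norm_zero]

theorem vnorm_sq {k : ℕ} (x : Fin k → ℝ) : vnorm x ^ 2 = x ⬝ᵥ x := by
  rw [vnorm, EuclideanSpace.norm_sq_eq]
  simp [dotProduct, sq]

theorem vnorm_smul {k : ℕ} (c : ℝ) (x : Fin k → ℝ) : vnorm (c • x) = |c| * vnorm x := by
  rw [vnorm, WithLp.toLp_smul, norm_smul, Real.norm_eq_abs, vnorm]

theorem vnorm_pos {k : ℕ} {x : Fin k → ℝ} (hx : x ≠ 0) : 0 < vnorm x :=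
  norm_pos_iff.2 (by simpa using hx)

theorem vnorm_single {k : ℕ} (i : Fin k) : vnorm (Pi.single i (1 : ℝ)) = 1 := by
  have h : vnorm (Pi.single i (1 : ℝ)) ^ 2 = 1 := by rw [vnorm_sq]; simp
  nlinarith [vnorm_nonneg (Pi.single i (1 : ℝ))]

theorem abs_dotProduct_le {k : ℕ} (x y : Fin k → ℝ) : |x ⬝ᵥ y| ≤ vnorm x * vnorm y := by
  have h := abs_real_inner_le_norm (WithLp.toLp 2 y) (WithLp.toLp 2 x)
  rw [EuclideanSpace.inner_toLp_toLp] at h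
  simpa [vnorm, mul_comm] using h

theorem specNorm_nonneg {p q : ℕ} (M : Matrix (Fin p) (Fin q) ℝ) : 0 ≤ specNorm M := norm_nonneg _

theorem vnorm_mulVec_le {p q : ℕ} (M : Matrix (Fin p) (Fin q) ℝ) (x : Fin q → ℝ) :
    vnorm (M *ᵥ x) ≤ specNorm M * vnorm x := by
  have h := (toEuclideanLin M).toContinuousLinearMap.le_opNorm (WithLp.toLp 2 x)
  simpa [vnorm, specNorm] using h

theorem specNorm_le {p q : ℕ} (M : Matrix (Fin p) (Fin q) ℝ) {c : ℝ} (hc : 0 ≤ c)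
    (h : ∀ x, vnorm (M *ᵥ x) ≤ c * vnorm x) : specNorm M ≤ c := by
  refine ContinuousLinearMap.opNorm_le_bound _ hc fun x => ?_
  exact h (WithLp.ofLp x)

theorem frobNorm_nonneg {ι κ : Type*} [Fintype ι] [Fintype κ] (M : Matrix ι κ ℝ) :
    0 ≤ frobNorm M := Real.sqrt_nonneg _

theorem frobNorm_sq {ι κ : Type*} [Fintype ι] [Fintype κ] (M : Matrix ι κ ℝ) :
    frobNorm M ^ 2 = ∑ i, ∑ j, M i j ^ 2 := Real.sq_sqrt (by positivity)

theorem specNorm_le_frobNorm {p q : ℕ} (M : Matrix (Fin p) (Fin q) ℝ) :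
    specNorm M ≤ frobNorm M := by
  refine specNorm_le M (frobNorm_nonneg M) fun x => ?_
  refine abs_le_of_sq_le_sq' ?_ (mul_nonneg (frobNorm_nonneg M) (vnorm_nonneg x)) |>.2
  rw [mul_pow, frobNorm_sq, vnorm_sq, vnorm_sq, Finset.sum_mul]
  refine Finset.sum_le_sum fun i _ => ?_
  have h := Finset.sum_mul_sq_le_sq_mul_sq Finset.univ (M i) x
  simpa [mulVec, dotProduct, sq] using h

/-- Expansion of a quadratic form at a linear combination of two vectors. -/
theorem quadForm_add_smul {k : ℕ} {X : Matrix (Fin k) (Fin k) ℝ} (hX : Xᵀ = X)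
    (x y : Fin k → ℝ) (s : ℝ) :
    (x + s • y) ⬝ᵥ (X *ᵥ (x + s • y)) =
      x ⬝ᵥ (X *ᵥ x) + 2 * s * (x ⬝ᵥ (X *ᵥ y)) + s ^ 2 * (y ⬝ᵥ (X *ᵥ y)) := by
  have h : y ⬝ᵥ (X *ᵥ x) = x ⬝ᵥ (X *ᵥ y) := by
    rw [dotProduct_mulVec, ← mulVec_transpose, hX, dotProduct_comm]
  simp only [mulVec_add, mulVec_smul, add_dotProduct, dotProduct_add, smul_dotProduct,
    dotProduct_smul, smul_eq_mul, h]
  ring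

/-- A bound of the quadratic form of a symmetric matrix bounds its bilinear form. -/
theorem abs_bilinForm_le {k : ℕ} {X : Matrix (Fin k) (Fin k) ℝ} (hX : Xᵀ = X) {ξ : ℝ}
    (h : ∀ x, |x ⬝ᵥ (X *ᵥ x)| ≤ ξ * vnorm x ^ 2) (x y : Fin k → ℝ) :
    |x ⬝ᵥ (X *ᵥ y)| ≤ ξ * (vnorm x * vnorm y) := by
  rcases eq_or_ne x 0 with rfl | hx
  · simp [vnorm]
  rcases eq_or_ne y 0 with rfl | hy
  · simp [vnorm]
  have hx' := vnorm_pos hx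
  have hy' := vnorm_pos hy
  have one : (1 : Matrix (Fin k) (Fin k) ℝ)ᵀ = 1 := transpose_one
  -- polarization at the vectors `x ± s y`, where `s = |x| / |y|` equalizes the lengths
  have key : ∀ s : ℝ, x ⬝ᵥ (X *ᵥ x) + 2 * s * (x ⬝ᵥ (X *ᵥ y)) + s ^ 2 * (y ⬝ᵥ (X *ᵥ y)) ≤
      ξ * (vnorm x ^ 2 + 2 * s * (x ⬝ᵥ y) + s ^ 2 * vnorm y ^ 2) ∧
      -(ξ * (vnorm x ^ 2 + 2 * s * (x ⬝ᵥ y) + s ^ 2 * vnorm y ^ 2)) ≤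
      x ⬝ᵥ (X *ᵥ x) + 2 * s * (x ⬝ᵥ (X *ᵥ y)) + s ^ 2 * (y ⬝ᵥ (X *ᵥ y)) := by
    intro s
    have h1 := h (x + s • y)
    have h2 := quadForm_add_smul one x y s
    simp only [one_mulVec] at h2
    rw [vnorm_sq, h2, quadForm_add_smul hX, abs_le] at h1
    rw [vnorm_sq, vnorm_sq]
    exact ⟨h1.2, h1.1⟩
  have k1 := key (vnorm x / vnorm y)
  have k2 := key (-(vnorm x / vnorm y))
  have e : (vnorm x / vnorm y) ^ 2 * vnorm y ^ 2 = vnorm x ^ 2 := by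
    field_simp
  have hs : 0 < vnorm x / vnorm y := by positivity
  have e2 : vnorm x / vnorm y * (ξ * (vnorm x * vnorm y)) = ξ * vnorm x ^ 2 := by
    field_simp
  rw [neg_sq, e] at k2
  rw [e] at k1
  rw [abs_le]
  constructor
  · refine le_of_mul_le_mul_left ?_ hs
    rw [mul_neg, e2]; nlinarith
  · refine le_of_mul_le_mul_left ?_ hs
    rw [e2]; nlinarith

theorem transpose_eq_of_posSemidef {k : ℕ} {X : Matrix (Fin k) (Fin k) ℝ} (hX : X.PosSemidef) :
    Xᵀ = X := by
  have := hX.1.eq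
  rwa [conjTranspose_eq_transpose_of_trivial] at this

theorem quadForm_nonneg {k : ℕ} {X : Matrix (Fin k) (Fin k) ℝ} (hX : X.PosSemidef)
    (x : Fin k → ℝ) : 0 ≤ x ⬝ᵥ (X *ᵥ x) := by
  simpa using hX.dotProduct_mulVec_nonneg x

/-- The weighted Young inequality for a semidefinite form. -/
theorem two_abs_bilinForm_le {k : ℕ} {X : Matrix (Fin k) (Fin k) ℝ} (hX : X.PosSemidef)
    {z : ℝ} (hz : 0 < z) (x y : Fin k → ℝ) :
    2 * |x ⬝ᵥ (X *ᵥ y)| ≤ x ⬝ᵥ (X *ᵥ x) / z + z * (y ⬝ᵥ (X *ᵥ y)) := by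
  have h1 := quadForm_nonneg hX (x + z • y)
  have h2 := quadForm_nonneg hX (x + (-z) • y)
  rw [quadForm_add_smul (transpose_eq_of_posSemidef hX)] at h1 h2
  have e : x ⬝ᵥ (X *ᵥ x) / z + z * (y ⬝ᵥ (X *ᵥ y)) =
      (x ⬝ᵥ (X *ᵥ x) + z ^ 2 * (y ⬝ᵥ (X *ᵥ y))) / z := by field_simp
  rw [e, le_div_iff₀ hz]
  rcases abs_cases (x ⬝ᵥ (X *ᵥ y)) with ⟨h, _⟩ | ⟨h, _⟩ <;> rw [h] <;> nlinarith

/-- The Rayleigh quotient of a symmetric operator is at least any lower bound of its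
eigenvalues. -/
theorem mul_sq_norm_le_of_le_eigenvalues {E : Type*} [NormedAddCommGroup E]
    [InnerProductSpace ℝ E] [FiniteDimensional ℝ E] {T : E →ₗ[ℝ] E} (hT : T.IsSymmetric) {k : ℕ}
    (hk : Module.finrank ℝ E = k) {c : ℝ} (h : ∀ i, c ≤ hT.eigenvalues hk i) (x : E) :
    c * ‖x‖ ^ 2 ≤ inner ℝ x (T x) := by
  set b := hT.eigenvectorBasis hk
  rw [← b.sum_sq_norm_inner_right x, ← b.sum_inner_mul_inner x (T x), Finset.mul_sum]
  refine Finset.sum_le_sum fun i _ => ?_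
  have e : inner ℝ (b i) (T x) = hT.eigenvalues hk i * inner ℝ (b i) x := by
    rw [← hT, hT.apply_eigenvectorBasis, inner_smul_left]; rfl
  rw [e, real_inner_comm, Real.norm_eq_abs, sq_abs, real_inner_comm]
  nlinarith [h i, sq_nonneg (inner ℝ x (b i) : ℝ)]

theorem sigmaMin_nonneg {k : ℕ} (X : Matrix (Fin k) (Fin k) ℝ) : 0 ≤ sigmaMin X :=
  LinearMap.singularValues_nonneg _ _

theorem sigmaMin_mul_vnorm_le {k : ℕ} (X : Matrix (Fin k) (Fin k) ℝ) (x : Fin k → ℝ) :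
    sigmaMin X * vnorm x ≤ vnorm (X *ᵥ x) := by
  rcases k with _ | k
  · simp [Subsingleton.elim x 0, vnorm, Subsingleton.elim _ (0 : EuclideanSpace ℝ (Fin 0))]
  set T := toEuclideanLin X with hT
  have hk : Module.finrank ℝ (EuclideanSpace ℝ (Fin (k + 1))) = k + 1 := by simp
  have h : ∀ i, sigmaMin X ^ 2 ≤ T.isSymmetric_adjoint_comp_self.eigenvalues hk i := by
    intro i
    rw [← T.sq_singularValues_fin hk i]
    exact pow_le_pow_left₀ (sigmaMin_nonneg X)
      (T.singularValues_antitone (by have := i.2; omega)) 2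
  have h2 := mul_sq_norm_le_of_le_eigenvalues T.isSymmetric_adjoint_comp_self hk h
    (WithLp.toLp 2 x)
  rw [LinearMap.comp_apply, LinearMap.adjoint_inner_right, real_inner_self_eq_norm_sq] at h2
  have h3 : ‖T (WithLp.toLp 2 x)‖ = vnorm (X *ᵥ x) := by simp [hT, vnorm]
  rw [h3, ← mul_pow] at h2
  exact abs_le_of_sq_le_sq' h2 (vnorm_nonneg _) |>.2

theorem sigmaMin_mul_sq_le {k : ℕ} {X : Matrix (Fin k) (Fin k) ℝ} (hX : X.PosDef)
    (x : Fin k → ℝ) : sigmaMin X * vnorm x ^ 2 ≤ x ⬝ᵥ (X *ᵥ x) := by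
  have hs : (toEuclideanLin X).IsSymmetric := isSymmetric_toEuclideanLin_iff.2 hX.1
  have hk : Module.finrank ℝ (EuclideanSpace ℝ (Fin k)) = k := by simp
  have h : ∀ i, sigmaMin X ≤ hs.eigenvalues hk i := by
    intro i
    set v := hs.eigenvectorBasis hk i with hv
    have e : toEuclideanLin X v = hs.eigenvalues hk i • v := hs.apply_eigenvectorBasis hk i
    have nv : ‖v‖ = 1 := (hs.eigenvectorBasis hk).norm_eq_one i
    have h1 := sigmaMin_mul_vnorm_le X (WithLp.ofLp v)
    have h2 : vnorm (X *ᵥ WithLp.ofLp v) = |hs.eigenvalues hk i| := by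
      have : vnorm (X *ᵥ WithLp.ofLp v) = ‖toEuclideanLin X v‖ := rfl
      rw [this, e, norm_smul, nv, mul_one, Real.norm_eq_abs]
    have h3 : 0 ≤ hs.eigenvalues hk i := by
      have := quadForm_nonneg hX.posSemidef (WithLp.ofLp v)
      have e2 : WithLp.ofLp v ⬝ᵥ (X *ᵥ WithLp.ofLp v) = inner ℝ (toEuclideanLin X v) v := by
        rw [EuclideanSpace.inner_eq_star_dotProduct]; simp [toEuclideanLin]
      rw [e2, e, inner_smul_left, real_inner_self_eq_norm_sq, nv] at this
      simpa using this
    have h4 : vnorm (WithLp.ofLp v) = 1 := nv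
    rw [h2, h4, abs_of_nonneg h3, mul_one] at h1
    exact h1
  have h2 := mul_sq_norm_le_of_le_eigenvalues hs hk h (WithLp.toLp 2 x)
  rw [EuclideanSpace.inner_eq_star_dotProduct] at h2
  simpa [vnorm, dotProduct_comm] using h2

theorem sigmaMin_pos {k : ℕ} (hk : 0 < k) {X : Matrix (Fin k) (Fin k) ℝ} (hX : X.PosDef) :
    0 < sigmaMin X := by
  have hinj : Function.Injective (toEuclideanLin X) := by
    rw [injective_iff_map_eq_zero]
    intro v hv
    by_contra hne
    have h := hX.dotProduct_mulVec_pos (x := WithLp.ofLp v) (by simpa using hne)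
    have h0 : X *ᵥ WithLp.ofLp v = 0 := congrArg WithLp.ofLp hv
    simp [h0] at h
  exact (toEuclideanLin X).injective_iff_forall_lt_finrank_singularValues_pos.1 hinj _
    (by simp; omega)

theorem sigmaMin_le_specNorm {k : ℕ} (hk : 0 < k) (X : Matrix (Fin k) (Fin k) ℝ) :
    sigmaMin X ≤ specNorm X := by
  have h := (sigmaMin_mul_vnorm_le X (Pi.single ⟨0, hk⟩ 1)).trans (vnorm_mulVec_le _ _)
  rwa [vnorm_single, mul_one, mul_one] at h

open Filter Topology
open scoped Matrix.Norms.L2Operator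

/-! ### Stable matrices and the discrete Lyapunov equation -/

/-- A square matrix is stable if its powers tend to zero; see `spectralRadius_map_lt_one_iff`. -/
def PowStable {k : ℕ} (A : Matrix (Fin k) (Fin k) ℝ) : Prop :=
  Tendsto (fun t : ℕ => A ^ t) atTop (𝓝 0)

theorem tendsto_pow_of_spectralRadius_lt_one {𝔸 : Type*} [NormedRing 𝔸] [NormedAlgebra ℂ 𝔸]
    [CompleteSpace 𝔸] {a : 𝔸} (h : spectralRadius ℂ a < 1) :
    Tendsto (fun t : ℕ => a ^ t) atTop (𝓝 0) := by
  obtain ⟨r, hr1, hr2⟩ := ENNReal.lt_iff_exists_nnreal_btwn.1 h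
  have hr2' : r < 1 := by exact_mod_cast hr2
  have hG := spectrum.pow_nnnorm_pow_one_div_tendsto_nhds_spectralRadius a
  have hev := (hG.eventually_lt_const hr1).and (eventually_gt_atTop 0)
  refine squeeze_zero_norm' (a := fun t : ℕ => (r : ℝ) ^ t) ?_
    (tendsto_pow_atTop_nhds_zero_of_lt_one r.2 (by exact_mod_cast hr2'))
  filter_upwards [hev] with t ht
  have ht0 : (t : ℝ) ≠ 0 := by exact_mod_cast ht.2.ne'
  have h1 := ENNReal.rpow_le_rpow ht.1.le (Nat.cast_nonneg (α := ℝ) t)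
  rw [← ENNReal.rpow_mul, one_div_mul_cancel ht0, ENNReal.rpow_one, ENNReal.rpow_natCast] at h1
  have h2 : ‖a ^ t‖₊ ≤ r ^ t := by exact_mod_cast h1
  exact_mod_cast h2

theorem spectralRadius_lt_one_of_norm_pow {𝔸 : Type*} [NormedRing 𝔸] [NormedAlgebra ℂ 𝔸]
    [CompleteSpace 𝔸] {a : 𝔸} (t : ℕ) (h : ‖a ^ (t + 1)‖ * ‖(1 : 𝔸)‖ < 1) :
    spectralRadius ℂ a < 1 := by
  refine (spectrum.spectralRadius_le_pow_nnnorm_pow_one_div ℂ a t).trans_lt ?_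
  have hp : (0 : ℝ) < 1 / (t + 1) := by positivity
  rw [← ENNReal.mul_rpow_of_nonneg _ _ hp.le]
  refine ENNReal.rpow_lt_one ?_ hp
  exact_mod_cast h

section Stable

variable {k : ℕ} {A : Matrix (Fin k) (Fin k) ℝ}

theorem map_ofReal_pow (A : Matrix (Fin k) (Fin k) ℝ) (t : ℕ) :
    (A ^ t).map Complex.ofReal = (A.map Complex.ofReal) ^ t :=
  map_pow (Complex.ofRealHom.mapMatrix (m := Fin k)) A t

theorem eventually_spectralRadius_map_lt_one (h : PowStable A) :
    ∀ᶠ A' in 𝓝 A, spectralRadius ℂ (A'.map Complex.ofReal) < 1 := by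
  have hc : Continuous fun A : Matrix (Fin k) (Fin k) ℝ => A.map Complex.ofReal :=
    continuous_id.matrix_map Complex.continuous_ofReal
  have h1 : Tendsto (fun t : ℕ => ‖(A.map Complex.ofReal) ^ (t + 1)‖ *
      ‖(1 : Matrix (Fin k) (Fin k) ℂ)‖) atTop (𝓝 0) := by
    have h2 := (hc.tendsto 0).comp h
    simp only [Function.comp_def, map_ofReal_pow] at h2
    have h3 := ((tendsto_add_atTop_iff_nat 1).2 h2).norm.mul_const
      ‖(1 : Matrix (Fin k) (Fin k) ℂ)‖
    convert h3 using 2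
    have : (0 : Matrix (Fin k) (Fin k) ℝ).map Complex.ofReal = 0 := by ext; simp
    rw [this]; simp
  obtain ⟨t, ht⟩ := (h1.eventually_lt_const one_pos).exists
  have hc2 : Continuous fun A : Matrix (Fin k) (Fin k) ℝ =>
      ‖(A.map Complex.ofReal) ^ (t + 1)‖ * ‖(1 : Matrix (Fin k) (Fin k) ℂ)‖ :=
    ((hc.pow _).norm).mul continuous_const
  filter_upwards [hc2.continuousAt.eventually_lt_const ht] with A' hA'
  exact spectralRadius_lt_one_of_norm_pow t hA'

theorem spectralRadius_map_lt_one_iff :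
    spectralRadius ℂ (A.map Complex.ofReal) < 1 ↔ PowStable A := by
  refine ⟨fun h => ?_, fun h => (eventually_spectralRadius_map_lt_one h).self_of_nhds⟩
  have hc : Continuous fun M : Matrix (Fin k) (Fin k) ℂ => M.map Complex.re :=
    continuous_id.matrix_map Complex.continuous_re
  have h2 := (hc.tendsto 0).comp (tendsto_pow_of_spectralRadius_lt_one h)
  have h0 : (0 : Matrix (Fin k) (Fin k) ℂ).map Complex.re = 0 := by ext; simp
  rw [h0] at h2
  refine h2.congr fun t => ?_
  ext i j
  simp [← map_ofReal_pow]

/-- A stable matrix stays stable under small perturbations. -/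
theorem PowStable.eventually (h : PowStable A) : ∀ᶠ A' in 𝓝 A, PowStable A' :=
  (eventually_spectralRadius_map_lt_one h).mono fun _ => spectralRadius_map_lt_one_iff.1

theorem PowStable.tendsto_mulVec (h : PowStable A) (x : Fin k → ℝ) :
    Tendsto (fun t : ℕ => A ^ t *ᵥ x) atTop (𝓝 0) := by
  have hc : Continuous fun M : Matrix (Fin k) (Fin k) ℝ => M *ᵥ x :=
    continuous_id.matrix_mulVec continuous_const
  simpa [Function.comp_def] using (hc.tendsto 0).comp h

theorem PowStable.tendsto_quadForm (h : PowStable A) (X : Matrix (Fin k) (Fin k) ℝ)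
    (x : Fin k → ℝ) :
    Tendsto (fun t : ℕ => (A ^ t *ᵥ x) ⬝ᵥ (X *ᵥ (A ^ t *ᵥ x))) atTop (𝓝 0) := by
  have hc : Continuous fun y : Fin k → ℝ => y ⬝ᵥ (X *ᵥ y) :=
    continuous_id.dotProduct (continuous_const.matrix_mulVec continuous_id)
  simpa [Function.comp_def] using (hc.tendsto 0).comp (h.tendsto_mulVec x)

/-- The Lyapunov operator `X ↦ X - Aᵀ X A`. -/
def lyapOp (A : Matrix (Fin k) (Fin k) ℝ) :
    Matrix (Fin k) (Fin k) ℝ →L[ℝ] Matrix (Fin k) (Fin k) ℝ :=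
  1 - (ContinuousLinearMap.mul ℝ (Matrix (Fin k) (Fin k) ℝ) Aᵀ) ∘L
    ((ContinuousLinearMap.mul ℝ (Matrix (Fin k) (Fin k) ℝ)).flip A)

theorem lyapOp_apply (A X : Matrix (Fin k) (Fin k) ℝ) : lyapOp A X = X - Aᵀ * X * A := by
  simp [lyapOp, mul_assoc]

/-- The solution `X` of the Lyapunov equation `X = Aᵀ X A + N`, for stable `A`. When the
Lyapunov operator is not invertible, `Ring.inverse` makes it zero. -/
def lyap (A N : Matrix (Fin k) (Fin k) ℝ) : Matrix (Fin k) (Fin k) ℝ :=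
  Ring.inverse (lyapOp A) N

theorem PowStable.isUnit_lyapOp (h : PowStable A) : IsUnit (lyapOp A) := by
  have hinj : Function.Injective (lyapOp A) := by
    rw [injective_iff_map_eq_zero]
    intro X hX
    rw [lyapOp_apply, sub_eq_zero] at hX
    have hpow : ∀ t : ℕ, (Aᵀ) ^ t * X * A ^ t = X := by
      intro t
      induction t with
      | zero => simp
      | succ t ih =>
        rw [pow_succ, pow_succ', show Aᵀ ^ t * Aᵀ * X * (A * A ^ t) =
          Aᵀ ^ t * (Aᵀ * X * A) * A ^ t by simp only [mul_assoc], ← hX, ih]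
    have h1 : Tendsto (fun t : ℕ => (Aᵀ) ^ t * X * A ^ t) atTop (𝓝 0) := by
      have hT : Tendsto (fun t : ℕ => Aᵀ ^ t) atTop (𝓝 0) := by
        have := ((continuous_id.matrix_transpose).tendsto (0 : Matrix (Fin k) (Fin k) ℝ)).comp h
        simpa [Function.comp_def, transpose_pow] using this
      simpa using (hT.mul_const X).mul h
    simp only [hpow] at h1
    exact tendsto_nhds_unique tendsto_const_nhds h1
  rw [ContinuousLinearMap.isUnit_iff_bijective]
  exact ⟨hinj, LinearMap.injective_iff_surjective (f := (lyapOp A).toLinearMap) |>.1 hinj⟩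

theorem PowStable.lyap_eq (h : PowStable A) (N : Matrix (Fin k) (Fin k) ℝ) :
    lyap A N = Aᵀ * lyap A N * A + N := by
  have h1 : lyapOp A (lyap A N) = N := by
    have := congrArg (fun T => T N) (Ring.mul_inverse_cancel _ h.isUnit_lyapOp)
    simpa [lyap] using this
  rw [lyapOp_apply] at h1
  rw [← sub_eq_iff_eq_add'.1 h1]

theorem PowStable.lyap_unique (h : PowStable A) {N X : Matrix (Fin k) (Fin k) ℝ}
    (hX : X = Aᵀ * X * A + N) : lyap A N = X := by
  have h1 : lyapOp A X = N := by rw [lyapOp_apply]; exact sub_eq_iff_eq_add'.2 hX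
  have := congrArg (fun T => T X) (Ring.inverse_mul_cancel _ h.isUnit_lyapOp)
  simpa [lyap, h1] using this

theorem lyap_add (A M N : Matrix (Fin k) (Fin k) ℝ) : lyap A (M + N) = lyap A M + lyap A N :=
  map_add _ _ _

theorem lyap_sub (A M N : Matrix (Fin k) (Fin k) ℝ) : lyap A (M - N) = lyap A M - lyap A N :=
  map_sub _ _ _

theorem lyap_smul (A N : Matrix (Fin k) (Fin k) ℝ) (c : ℝ) : lyap A (c • N) = c • lyap A N :=
  map_smul _ _ _

theorem PowStable.lyap_transpose (h : PowStable A) {N : Matrix (Fin k) (Fin k) ℝ}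
    (hN : Nᵀ = N) : (lyap A N)ᵀ = lyap A N := by
  refine (h.lyap_unique ?_).symm
  conv_lhs => rw [h.lyap_eq N]
  simp [hN, mul_assoc]

/-- One step of the trajectory changes the Lyapunov function by the quadratic form of the
source. -/
theorem quadForm_eq_of_lyapunov {X N : Matrix (Fin k) (Fin k) ℝ} (hX : X = Aᵀ * X * A + N)
    (x : Fin k → ℝ) :
    x ⬝ᵥ (X *ᵥ x) = (A *ᵥ x) ⬝ᵥ (X *ᵥ (A *ᵥ x)) + x ⬝ᵥ (N *ᵥ x) := by
  conv_lhs => rw [hX]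
  rw [add_mulVec, dotProduct_add, ← mulVec_mulVec, ← mulVec_mulVec, dotProduct_mulVec x Aᵀ,
    vecMul_transpose]

theorem PowStable.lyap_quadForm (h : PowStable A) (N : Matrix (Fin k) (Fin k) ℝ)
    (x : Fin k → ℝ) :
    x ⬝ᵥ (lyap A N *ᵥ x) = (A *ᵥ x) ⬝ᵥ (lyap A N *ᵥ (A *ᵥ x)) + x ⬝ᵥ (N *ᵥ x) :=
  quadForm_eq_of_lyapunov (h.lyap_eq N) x

/-- The value of the Lyapunov function is the sum of the source along the trajectory. -/
theorem PowStable.hasSum_lyap (h : PowStable A) (N : Matrix (Fin k) (Fin k) ℝ) {x : Fin k → ℝ}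
    (hN : ∀ x, 0 ≤ x ⬝ᵥ (N *ᵥ x)) :
    HasSum (fun t : ℕ => (A ^ t *ᵥ x) ⬝ᵥ (N *ᵥ (A ^ t *ᵥ x))) (x ⬝ᵥ (lyap A N *ᵥ x)) := by
  rw [hasSum_iff_tendsto_nat_of_nonneg fun t => hN _]
  have hs : ∀ T : ℕ, ∑ t ∈ Finset.range T, (A ^ t *ᵥ x) ⬝ᵥ (N *ᵥ (A ^ t *ᵥ x)) =
      x ⬝ᵥ (lyap A N *ᵥ x) - (A ^ T *ᵥ x) ⬝ᵥ (lyap A N *ᵥ (A ^ T *ᵥ x)) := by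
    intro T
    induction T with
    | zero => simp
    | succ T ih =>
      have := h.lyap_quadForm N (A ^ T *ᵥ x)
      rw [Finset.sum_range_succ, ih, pow_succ', ← mulVec_mulVec]
      linarith
  simp only [hs]
  simpa using (h.tendsto_quadForm (lyap A N) x).const_sub (x ⬝ᵥ (lyap A N *ᵥ x))

theorem PowStable.lyap_nonneg (h : PowStable A) {N : Matrix (Fin k) (Fin k) ℝ}
    (hN : ∀ x, 0 ≤ x ⬝ᵥ (N *ᵥ x)) (x : Fin k → ℝ) : 0 ≤ x ⬝ᵥ (lyap A N *ᵥ x) :=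
  (h.hasSum_lyap N hN).nonneg fun _ => hN _

theorem PowStable.lyap_mono (h : PowStable A) {M N : Matrix (Fin k) (Fin k) ℝ}
    (hMN : ∀ x, x ⬝ᵥ (M *ᵥ x) ≤ x ⬝ᵥ (N *ᵥ x)) (x : Fin k → ℝ) :
    x ⬝ᵥ (lyap A M *ᵥ x) ≤ x ⬝ᵥ (lyap A N *ᵥ x) := by
  have := h.lyap_nonneg (N := N - M) (fun x => by
    rw [sub_mulVec, dotProduct_sub]; linarith [hMN x]) x
  rw [lyap_sub, sub_mulVec, dotProduct_sub] at this
  linarith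

theorem PowStable.abs_lyap_le (h : PowStable A) {M N : Matrix (Fin k) (Fin k) ℝ}
    (hMN : ∀ x, |x ⬝ᵥ (M *ᵥ x)| ≤ x ⬝ᵥ (N *ᵥ x)) (x : Fin k → ℝ) :
    |x ⬝ᵥ (lyap A M *ᵥ x)| ≤ x ⬝ᵥ (lyap A N *ᵥ x) := by
  have h1 := h.lyap_mono (M := (-1 : ℝ) • M) (N := N) (fun x => by
    simpa [neg_mulVec] using (abs_le'.1 (hMN x)).2) x
  rw [lyap_smul] at h1
  refine abs_le'.2 ⟨h.lyap_mono (fun x => (abs_le'.1 (hMN x)).1) x, ?_⟩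
  simpa [neg_mulVec] using h1

/-- **Lyapunov's theorem**: a semidefinite solution of a Lyapunov equation with definite source
certifies stability. -/
theorem powStable_of_lyapunov {X N : Matrix (Fin k) (Fin k) ℝ} (hX : X = Aᵀ * X * A + N)
    (hX0 : ∀ x, 0 ≤ x ⬝ᵥ (X *ᵥ x)) {c : ℝ} (hc : 0 < c)
    (hN : ∀ x, c * vnorm x ^ 2 ≤ x ⬝ᵥ (N *ᵥ x)) : PowStable A := by
  have hvec : ∀ x, Tendsto (fun t : ℕ => A ^ t *ᵥ x) atTop (𝓝 0) := by
    intro x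
    have hs : ∀ T : ℕ, ∑ t ∈ Finset.range T, vnorm (A ^ t *ᵥ x) ^ 2 ≤
        (x ⬝ᵥ (X *ᵥ x) - (A ^ T *ᵥ x) ⬝ᵥ (X *ᵥ (A ^ T *ᵥ x))) / c := by
      intro T
      induction T with
      | zero => simp
      | succ T ih =>
        have := quadForm_eq_of_lyapunov hX (A ^ T *ᵥ x)
        have h2 := hN (A ^ T *ᵥ x)
        rw [le_div_iff₀ hc] at ih ⊢
        rw [Finset.sum_range_succ, pow_succ' A, ← mulVec_mulVec]
        linarith
    have hsum : Summable fun t : ℕ => vnorm (A ^ t *ᵥ x) ^ 2 := by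
      refine summable_of_sum_range_le (c := x ⬝ᵥ (X *ᵥ x) / c) (fun t => sq_nonneg _) fun T =>
        (hs T).trans ?_
      gcongr
      linarith [hX0 (A ^ T *ᵥ x)]
    have h0 : Tendsto (fun t : ℕ => vnorm (A ^ t *ᵥ x)) atTop (𝓝 0) := by
      have := (hsum.tendsto_atTop_zero).sqrt
      simpa [Real.sqrt_sq (vnorm_nonneg _)] using this
    have h1 : Tendsto (fun t : ℕ => WithLp.toLp 2 (A ^ t *ᵥ x)) atTop (𝓝 0) :=
      tendsto_zero_iff_norm_tendsto_zero.2 h0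
    have h2 := ((PiLp.continuous_ofLp 2 fun _ : Fin k => ℝ).tendsto 0).comp h1
    simpa [Function.comp_def] using h2
  refine tendsto_pi_nhds.2 fun i => tendsto_pi_nhds.2 fun j => ?_
  have := (tendsto_pi_nhds.1 (hvec (Pi.single j 1))) i
  simpa using this

theorem contDiffAt_inverse_of_isUnit {E : Type*} [NormedAddCommGroup E] [NormedSpace ℝ E]
    [CompleteSpace E] {T : E →L[ℝ] E} (h : IsUnit T) :
    ContDiffAt ℝ ⊤ (Ring.inverse : (E →L[ℝ] E) → (E →L[ℝ] E)) T := by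
  obtain ⟨u, rfl⟩ := h
  exact contDiffAt_ringInverse (R := E →L[ℝ] E) ℝ u

theorem contDiff_lyapOp : ContDiff ℝ ⊤ (lyapOp (k := k)) := by
  have hT : ContDiff ℝ ⊤ fun A : Matrix (Fin k) (Fin k) ℝ => Aᵀ :=
    (LinearMap.toContinuousLinearMap (transposeLinearEquiv (Fin k) (Fin k) ℝ ℝ).toLinearMap).contDiff
  exact contDiff_const.sub (((ContinuousLinearMap.mul ℝ
    (Matrix (Fin k) (Fin k) ℝ)).contDiff.comp hT).clm_comp
    (ContinuousLinearMap.contDiff _))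

/-- The solution of the Lyapunov equation depends smoothly on the data. -/
theorem PowStable.contDiffAt_lyap {E : Type*} [NormedAddCommGroup E] [NormedSpace ℝ E]
    {F G : E → Matrix (Fin k) (Fin k) ℝ} {v : E} (h : PowStable (F v))
    (hF : ContDiffAt ℝ ⊤ F v) (hG : ContDiffAt ℝ ⊤ G v) :
    ContDiffAt ℝ ⊤ (fun w => lyap (F w) (G w)) v := by
  have h1 := contDiffAt_inverse_of_isUnit h.isUnit_lyapOp
  exact ((h1.comp (F v) contDiff_lyapOp.contDiffAt).comp v hF).clm_apply hG

theorem HasDerivAt.matrix_transpose {m n : ℕ} {F : ℝ → Matrix (Fin m) (Fin n) ℝ}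
    {F' : Matrix (Fin m) (Fin n) ℝ} {s : ℝ} (h : HasDerivAt F F' s) :
    HasDerivAt (fun t => (F t)ᵀ) F'ᵀ s :=
  (LinearMap.toContinuousLinearMap
    (transposeLinearEquiv (Fin m) (Fin n) ℝ ℝ).toLinearMap).hasFDerivAt.comp_hasDerivAt s h

/-- Differentiating the Lyapunov equation: the derivative of the solution solves a Lyapunov
equation with the same operator. -/
theorem PowStable.hasDerivAt_lyap {F G : ℝ → Matrix (Fin k) (Fin k) ℝ}
    {F' G' : Matrix (Fin k) (Fin k) ℝ} {s : ℝ} (h : PowStable (F s))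
    (hF : HasDerivAt F F' s) (hG : HasDerivAt G G' s) :
    HasDerivAt (fun t => lyap (F t) (G t))
      (lyap (F s) (F'ᵀ * lyap (F s) (G s) * F s + (F s)ᵀ * lyap (F s) (G s) * F' + G')) s := by
  have hdiff : DifferentiableAt ℝ (fun t => lyap (F t) (G t)) s := by
    have h1 := (contDiffAt_inverse_of_isUnit h.isUnit_lyapOp).differentiableAt (by simp)
    exact ((h1.comp (F s) (contDiff_lyapOp.differentiable (by simp) _)).comp s
      hF.differentiableAt).clm_apply hG.differentiableAt
  have hX := hdiff.hasDerivAt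
  set X' := deriv (fun t => lyap (F t) (G t)) s
  have hR := ((hF.matrix_transpose.mul hX).mul hF).add hG
  have hev : ∀ᶠ t in 𝓝 s, lyap (F t) (G t) = (F t)ᵀ * lyap (F t) (G t) * F t + G t := by
    filter_upwards [hF.continuousAt.eventually h.eventually] with t ht
    exact ht.lyap_eq _
  have hX2 := hX.congr_of_eventuallyEq (hev.mono fun _ ht => ht.symm)
  have e := hR.unique hX2
  have : lyap (F s) (F'ᵀ * lyap (F s) (G s) * F s + (F s)ᵀ * lyap (F s) (G s) * F' + G') = X' := by
    refine h.lyap_unique ?_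
    conv_lhs => rw [← e]
    simp only [add_mul, Pi.mul_apply]
    abel
  rw [this]
  exact hX

end Stable

/-! ### The value matrix and its directional derivatives -/

/-- The symmetrized product `Uᵀ X V + Vᵀ X U`. -/
def crossForm {a k : ℕ} (U : Matrix (Fin a) (Fin k) ℝ) (X : Matrix (Fin a) (Fin a) ℝ)
    (V : Matrix (Fin a) (Fin k) ℝ) : Matrix (Fin k) (Fin k) ℝ :=
  Uᵀ * X * V + Vᵀ * X * U

theorem crossForm_transpose {a k : ℕ} {X : Matrix (Fin a) (Fin a) ℝ} (hX : Xᵀ = X)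
    (U V : Matrix (Fin a) (Fin k) ℝ) : (crossForm U X V)ᵀ = crossForm U X V := by
  simp [crossForm, hX, Matrix.mul_assoc, add_comm]

theorem dotProduct_transpose_mul_mulVec {a k : ℕ} (U V : Matrix (Fin a) (Fin k) ℝ)
    (X : Matrix (Fin a) (Fin a) ℝ) (x : Fin k → ℝ) :
    x ⬝ᵥ ((Uᵀ * X * V) *ᵥ x) = (U *ᵥ x) ⬝ᵥ (X *ᵥ (V *ᵥ x)) := by
  rw [← mulVec_mulVec, ← mulVec_mulVec, dotProduct_mulVec x Uᵀ, vecMul_transpose]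

theorem quadForm_crossForm {a k : ℕ} {X : Matrix (Fin a) (Fin a) ℝ} (hX : Xᵀ = X)
    (U V : Matrix (Fin a) (Fin k) ℝ) (x : Fin k → ℝ) :
    x ⬝ᵥ (crossForm U X V *ᵥ x) = 2 * ((U *ᵥ x) ⬝ᵥ (X *ᵥ (V *ᵥ x))) := by
  have h : (V *ᵥ x) ⬝ᵥ (X *ᵥ (U *ᵥ x)) = (U *ᵥ x) ⬝ᵥ (X *ᵥ (V *ᵥ x)) := by
    rw [dotProduct_mulVec, ← mulVec_transpose, hX, dotProduct_comm]
  rw [crossForm, add_mulVec, dotProduct_add, dotProduct_transpose_mul_mulVec,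
    dotProduct_transpose_mul_mulVec, h, two_mul]

theorem HasDerivAt.matrix_mul {a b c : ℕ} {F : ℝ → Matrix (Fin a) (Fin b) ℝ}
    {G : ℝ → Matrix (Fin b) (Fin c) ℝ} {F' : Matrix (Fin a) (Fin b) ℝ}
    {G' : Matrix (Fin b) (Fin c) ℝ} {s : ℝ} (hF : HasDerivAt F F' s) (hG : HasDerivAt G G' s) :
    HasDerivAt (fun t => F t * G t) (F' * G s + F s * G') s := by
  rw [hasDerivAt_iff_tendsto_slope] at *
  have h1 : Tendsto (fun t => slope F s t * G t + F s * slope G s t) (𝓝[≠] s)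
      (𝓝 (F' * G s + F s * G')) := by
    have hGc : Tendsto G (𝓝[≠] s) (𝓝 (G s)) :=
      (hasDerivAt_iff_tendsto_slope.2 hG).continuousAt.tendsto.mono_left nhdsWithin_le_nhds
    have hm1 : Continuous fun p : Matrix (Fin a) (Fin b) ℝ × Matrix (Fin b) (Fin c) ℝ =>
      p.1 * p.2 := continuous_fst.matrix_mul continuous_snd
    exact ((hm1.tendsto (F', G s)).comp (hF.prodMk_nhds hGc)).add
      ((hm1.tendsto (F s, G')).comp (tendsto_const_nhds.prodMk_nhds hG))
  refine h1.congr fun t => ?_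
  simp only [slope, vsub_eq_sub, Matrix.smul_mul, Matrix.mul_smul, ← smul_add,
    Matrix.sub_mul, Matrix.mul_sub]
  congr 1
  abel

theorem HasDerivAt.crossForm {a k : ℕ} {U V : ℝ → Matrix (Fin a) (Fin k) ℝ}
    {X : ℝ → Matrix (Fin a) (Fin a) ℝ} {U' V' : Matrix (Fin a) (Fin k) ℝ}
    {X' : Matrix (Fin a) (Fin a) ℝ} {s : ℝ} (hU : HasDerivAt U U' s) (hX : HasDerivAt X X' s)
    (hV : HasDerivAt V V' s) :
    HasDerivAt (fun t => crossForm (U t) (X t) (V t))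
      (_root_.crossForm U' (X s) (V s) + _root_.crossForm (U s) X' (V s) +
        _root_.crossForm (U s) (X s) V') s := by
  have h := ((hU.matrix_transpose.matrix_mul hX).matrix_mul hV).add
    ((hV.matrix_transpose.matrix_mul hX).matrix_mul hU)
  convert! h using 1
  simp only [_root_.crossForm, Matrix.add_mul]
  abel

namespace SOFProblem

variable {n m d : ℕ} (S : SOFProblem n m d)

theorem mem_feasible_iff {K : Matrix (Fin m) (Fin d) ℝ} :
    K ∈ S.feasible ↔ PowStable (S.closedLoop K) :=
  spectralRadius_map_lt_one_iff

/-- The direction `-B Z C` in which the closed-loop matrix moves when the gain moves along `Z`. -/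
def loopDir (Z : Matrix (Fin m) (Fin d) ℝ) : Matrix (Fin n) (Fin n) ℝ := -(S.B * Z * S.C)

/-- The weight `Q + (K C)ᵀ R (K C)` of the state in the stage cost. -/
def stageWeight (K : Matrix (Fin m) (Fin d) ℝ) : Matrix (Fin n) (Fin n) ℝ :=
  S.Q + (K * S.C)ᵀ * S.R * (K * S.C)

/-- The value matrix `P`: the cost accumulated from the state `x` is `xᵀ P x`. -/
def value (K : Matrix (Fin m) (Fin d) ℝ) : Matrix (Fin n) (Fin n) ℝ :=
  lyap (S.closedLoop K) (S.stageWeight K)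

/-- The source of the Lyapunov equation of `value₁`. -/
def source₁ (K Z : Matrix (Fin m) (Fin d) ℝ) : Matrix (Fin n) (Fin n) ℝ :=
  crossForm (S.loopDir Z) (S.value K) (S.closedLoop K) + crossForm (Z * S.C) S.R (K * S.C)

/-- The derivative of the value matrix at `K` along `Z`. -/
def value₁ (K Z : Matrix (Fin m) (Fin d) ℝ) : Matrix (Fin n) (Fin n) ℝ :=
  lyap (S.closedLoop K) (S.source₁ K Z)

/-- The source of the Lyapunov equation of `value₂`. -/
def source₂ (K Z Y : Matrix (Fin m) (Fin d) ℝ) : Matrix (Fin n) (Fin n) ℝ :=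
  crossForm (S.loopDir Z) (S.value₁ K Y) (S.closedLoop K) +
    crossForm (S.loopDir Y) (S.value₁ K Z) (S.closedLoop K) +
    crossForm (S.loopDir Z) (S.value K) (S.loopDir Y) + crossForm (Z * S.C) S.R (Y * S.C)

/-- The second derivative of the value matrix at `K` along `Z` and `Y`. -/
def value₂ (K Z Y : Matrix (Fin m) (Fin d) ℝ) : Matrix (Fin n) (Fin n) ℝ :=
  lyap (S.closedLoop K) (S.source₂ K Z Y)

/-- The source of the Lyapunov equation of `value₃`. -/
def source₃ (K Z Y H : Matrix (Fin m) (Fin d) ℝ) : Matrix (Fin n) (Fin n) ℝ :=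
  crossForm (S.loopDir Z) (S.value₂ K Y H) (S.closedLoop K) +
    crossForm (S.loopDir Y) (S.value₂ K Z H) (S.closedLoop K) +
    crossForm (S.loopDir H) (S.value₂ K Z Y) (S.closedLoop K) +
    crossForm (S.loopDir Z) (S.value₁ K Y) (S.loopDir H) +
    crossForm (S.loopDir Y) (S.value₁ K Z) (S.loopDir H) +
    crossForm (S.loopDir Z) (S.value₁ K H) (S.loopDir Y)

/-- The third derivative of the value matrix at `K` along `Z`, `Y` and `H`. -/
def value₃ (K Z Y H : Matrix (Fin m) (Fin d) ℝ) : Matrix (Fin n) (Fin n) ℝ :=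
  lyap (S.closedLoop K) (S.source₃ K Z Y H)

theorem hasDerivAt_line (K H : Matrix (Fin m) (Fin d) ℝ) (s : ℝ) :
    HasDerivAt (fun t : ℝ => K + t • H) H s := by
  simpa using ((hasDerivAt_id s).smul_const H).const_add K

theorem hasDerivAt_mul_C (K H : Matrix (Fin m) (Fin d) ℝ) (s : ℝ) :
    HasDerivAt (fun t : ℝ => (K + t • H) * S.C) (H * S.C) s := by
  simpa using (hasDerivAt_line K H s).matrix_mul (hasDerivAt_const s S.C)

theorem hasDerivAt_closedLoop (K H : Matrix (Fin m) (Fin d) ℝ) (s : ℝ) :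
    HasDerivAt (fun t : ℝ => S.closedLoop (K + t • H)) (S.loopDir H) s := by
  have := ((hasDerivAt_const s S.B).matrix_mul (S.hasDerivAt_mul_C K H s)).const_sub S.A
  simpa [closedLoop, loopDir, Matrix.mul_assoc] using this

variable {S} {K Z Y H : Matrix (Fin m) (Fin d) ℝ} {s : ℝ}

theorem hasDerivAt_value (h : PowStable (S.closedLoop (K + s • H))) :
    HasDerivAt (fun t : ℝ => S.value (K + t • H)) (S.value₁ (K + s • H) H) s := by
  have hC := S.hasDerivAt_mul_C K H s
  have hw := ((hC.matrix_transpose.matrix_mul (hasDerivAt_const s S.R)).matrix_mul hC).const_add S.Q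
  have := h.hasDerivAt_lyap (S.hasDerivAt_closedLoop K H s) hw
  convert! this using 1
  rw [value₁, source₁, crossForm, crossForm]
  simp [value, stageWeight]

theorem hasDerivAt_value₁ (h : PowStable (S.closedLoop (K + s • H))) :
    HasDerivAt (fun t : ℝ => S.value₁ (K + t • H) Z) (S.value₂ (K + s • H) Z H) s := by
  have hw := ((hasDerivAt_const s (S.loopDir Z)).crossForm (hasDerivAt_value h)
    (S.hasDerivAt_closedLoop K H s)).add ((hasDerivAt_const s (Z * S.C)).crossForm
    (hasDerivAt_const s S.R) (S.hasDerivAt_mul_C K H s))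
  have := h.hasDerivAt_lyap (S.hasDerivAt_closedLoop K H s) hw
  convert! this using 1
  rw [value₂, source₂]
  congr 1
  simp only [crossForm, value₁, source₁, Pi.add_apply, transpose_zero, zero_mul, mul_zero,
    Matrix.zero_mul, Matrix.mul_zero]
  abel

theorem hasDerivAt_value₂ (h : PowStable (S.closedLoop (K + s • H))) :
    HasDerivAt (fun t : ℝ => S.value₂ (K + t • H) Z Y) (S.value₃ (K + s • H) Z Y H) s := by
  have hA := S.hasDerivAt_closedLoop K H s
  have hc : ∀ {a b : ℕ} (M : Matrix (Fin a) (Fin b) ℝ), HasDerivAt (fun _ : ℝ => M) 0 s :=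
    fun M => hasDerivAt_const s M
  have hw := ((((hc (S.loopDir Z)).crossForm (hasDerivAt_value₁ (Z := Y) h) hA).add
    ((hc (S.loopDir Y)).crossForm (hasDerivAt_value₁ (Z := Z) h) hA)).add
    ((hc (S.loopDir Z)).crossForm (hasDerivAt_value h) (hc (S.loopDir Y)))).add
    ((hc (Z * S.C)).crossForm (hc S.R) (hc (Y * S.C)))
  have := h.hasDerivAt_lyap hA hw
  convert! this using 1
  rw [value₃, source₃]
  congr 1
  simp only [crossForm, value₂, source₂, Pi.add_apply, transpose_zero, zero_mul, mul_zero,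
    Matrix.zero_mul, Matrix.mul_zero]
  abel

end SOFProblem

namespace SOFProblem

variable {n m d : ℕ} {S : SOFProblem n m d} {K Z Y H : Matrix (Fin m) (Fin d) ℝ}

/-! ### The cost as a trace and its derivatives -/

theorem input_eq (S : SOFProblem n m d) (K : Matrix (Fin m) (Fin d) ℝ) (x : Fin n → ℝ) :
    S.input K x = -((K * S.C) *ᵥ x) := by
  rw [input, mulVec_mulVec]

theorem state_eq (S : SOFProblem n m d) (K : Matrix (Fin m) (Fin d) ℝ) (x : Fin n → ℝ) (t : ℕ) :
    S.state K x t = S.closedLoop K ^ t *ᵥ x := by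
  induction t with
  | zero => simp [state]
  | succ t ih =>
    rw [state, ih, input_eq, pow_succ', ← mulVec_mulVec x]
    generalize S.closedLoop K ^ t *ᵥ x = y
    rw [closedLoop, mulVec_neg, sub_mulVec, ← sub_eq_add_neg, mulVec_mulVec _ S.B, Matrix.mul_assoc]

theorem quadForm_stageWeight (S : SOFProblem n m d) (K : Matrix (Fin m) (Fin d) ℝ)
    (x : Fin n → ℝ) :
    x ⬝ᵥ (S.stageWeight K *ᵥ x) =
      x ⬝ᵥ (S.Q *ᵥ x) + ((K * S.C) *ᵥ x) ⬝ᵥ (S.R *ᵥ ((K * S.C) *ᵥ x)) := by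
  rw [stageWeight, add_mulVec, dotProduct_add, dotProduct_transpose_mul_mulVec]

theorem stageCost_eq (S : SOFProblem n m d) (K : Matrix (Fin m) (Fin d) ℝ) (x : Fin n → ℝ)
    (t : ℕ) : S.stageCost K x t =
      (S.closedLoop K ^ t *ᵥ x) ⬝ᵥ (S.stageWeight K *ᵥ (S.closedLoop K ^ t *ᵥ x)) := by
  rw [stageCost, quadForm_stageWeight, input_eq, state_eq]
  simp [mulVec_neg]

theorem stageWeight_quadForm_nonneg (hQ : S.Q.PosDef) (hR : S.R.PosDef) (x : Fin n → ℝ) :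
    0 ≤ x ⬝ᵥ (S.stageWeight K *ᵥ x) := by
  rw [quadForm_stageWeight]
  exact add_nonneg (quadForm_nonneg hQ.posSemidef _) (quadForm_nonneg hR.posSemidef _)

theorem integrable_coord_mul (hD : MemLp (fun x : Fin n → ℝ => x) 2 S.D) (i j : Fin n) :
    Integrable (fun x : Fin n → ℝ => x i * x j) S.D := by
  have h : ∀ i, MemLp (fun x : Fin n → ℝ => x i) 2 S.D := fun i =>
    hD.of_le (continuous_apply i).aestronglyMeasurable (ae_of_all _ fun x => norm_le_pi_norm x i)
  exact (h i).integrable_mul (h j)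

theorem quadForm_eq_sum {k : ℕ} (X : Matrix (Fin k) (Fin k) ℝ) (x : Fin k → ℝ) :
    x ⬝ᵥ (X *ᵥ x) = ∑ i, ∑ j, X i j * (x i * x j) := by
  simp only [dotProduct, mulVec, Finset.mul_sum]
  exact Finset.sum_congr rfl fun i _ => Finset.sum_congr rfl fun j _ => by ring

theorem integral_quadForm (hD : MemLp (fun x : Fin n → ℝ => x) 2 S.D)
    (X : Matrix (Fin n) (Fin n) ℝ) :
    ∫ x, x ⬝ᵥ (X *ᵥ x) ∂S.D = trace (S.X0 * X) := by
  have hi : ∀ i j, Integrable (fun x : Fin n → ℝ => X i j * (x i * x j)) S.D := fun i j =>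
    (integrable_coord_mul hD i j).const_mul _
  simp only [quadForm_eq_sum]
  rw [integral_finsetSum _ fun i _ => integrable_finsetSum _ fun j _ => hi i j]
  simp only [trace, diag, mul_apply]
  rw [Finset.sum_comm]
  refine Finset.sum_congr rfl fun i _ => ?_
  rw [integral_finsetSum _ fun j _ => hi i j]
  refine Finset.sum_congr rfl fun j _ => ?_
  rw [integral_const_mul, X0, of_apply, mul_comm]
  simp only [mul_comm]

/-- The trace pairing with `X₀` is monotone for the order of quadratic forms, since it is the
expectation of the quadratic form at the initial state. -/
theorem trace_X0_nonneg (hD : MemLp (fun x : Fin n → ℝ => x) 2 S.D)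
    {X : Matrix (Fin n) (Fin n) ℝ} (hX : ∀ x, 0 ≤ x ⬝ᵥ (X *ᵥ x)) : 0 ≤ trace (S.X0 * X) := by
  rw [← integral_quadForm hD]
  exact integral_nonneg hX

theorem trace_X0_mono (hD : MemLp (fun x : Fin n → ℝ => x) 2 S.D)
    {X Y : Matrix (Fin n) (Fin n) ℝ} (h : ∀ x, x ⬝ᵥ (X *ᵥ x) ≤ x ⬝ᵥ (Y *ᵥ x)) :
    trace (S.X0 * X) ≤ trace (S.X0 * Y) := by
  have := trace_X0_nonneg hD (X := Y - X) fun x => by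
    rw [sub_mulVec, dotProduct_sub]; linarith [h x]
  rw [Matrix.mul_sub, trace_sub] at this
  linarith

theorem cost_eq_trace (hD : MemLp (fun x : Fin n → ℝ => x) 2 S.D) (hQ : S.Q.PosDef)
    (hR : S.R.PosDef) (hK : PowStable (S.closedLoop K)) :
    S.cost K = trace (S.X0 * S.value K) := by
  rw [cost, ← integral_quadForm hD]
  refine integral_congr_ae (ae_of_all _ fun x => ?_)
  simp only [stageCost_eq]
  exact (hK.hasSum_lyap _ (stageWeight_quadForm_nonneg hQ hR)).tsum_eq

/-- The gain matrix with a given vectorization. -/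
def gainOfVec (m d : ℕ) : (Fin d × Fin m → ℝ) →L[ℝ] Matrix (Fin m) (Fin d) ℝ :=
  LinearMap.toContinuousLinearMap
    { toFun := fun v => Matrix.of fun i j => v (j, i)
      map_add' := fun _ _ => rfl
      map_smul' := fun _ _ => rfl }

theorem gainOfVec_vec (K : Matrix (Fin m) (Fin d) ℝ) : gainOfVec m d (vec K) = K := rfl

theorem vec_gainOfVec (v : Fin d × Fin m → ℝ) : vec (gainOfVec m d v) = v := rfl

theorem continuous_closedLoop (S : SOFProblem n m d) : Continuous S.closedLoop :=
  continuous_const.sub ((continuous_const.matrix_mul continuous_id).matrix_mul continuous_const)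

theorem eventually_powStable_gainOfVec {v : Fin d × Fin m → ℝ}
    (h : PowStable (S.closedLoop (gainOfVec m d v))) :
    ∀ᶠ w in 𝓝 v, PowStable (S.closedLoop (gainOfVec m d w)) :=
  (S.continuous_closedLoop.comp (gainOfVec m d).continuous).continuousAt.eventually h.eventually

theorem costVec_eventuallyEq (hD : MemLp (fun x : Fin n → ℝ => x) 2 S.D) (hQ : S.Q.PosDef)
    (hR : S.R.PosDef) {v : Fin d × Fin m → ℝ} (h : PowStable (S.closedLoop (gainOfVec m d v))) :
    S.costVec =ᶠ[𝓝 v] fun w => trace (S.X0 * S.value (gainOfVec m d w)) :=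
  (eventually_powStable_gainOfVec h).mono fun _ hw => cost_eq_trace hD hQ hR hw

/-- The pairing `X ↦ tr (X₀ X)` as a continuous linear functional. -/
def traceX0 (S : SOFProblem n m d) : Matrix (Fin n) (Fin n) ℝ →L[ℝ] ℝ :=
  LinearMap.toContinuousLinearMap (traceLinearMap (Fin n) ℝ ℝ ∘ₗ LinearMap.mulLeft ℝ S.X0)

theorem traceX0_apply (X : Matrix (Fin n) (Fin n) ℝ) : S.traceX0 X = trace (S.X0 * X) := rfl

theorem contDiff_mul_left {a b c : ℕ} (M : Matrix (Fin a) (Fin b) ℝ) :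
    ContDiff ℝ ⊤ fun X : Matrix (Fin b) (Fin c) ℝ => M * X :=
  (LinearMap.toContinuousLinearMap (mulLeftLinearMap (Fin c) ℝ M)).contDiff

theorem contDiff_mul_right {a b c : ℕ} (M : Matrix (Fin b) (Fin c) ℝ) :
    ContDiff ℝ ⊤ fun X : Matrix (Fin a) (Fin b) ℝ => X * M :=
  (LinearMap.toContinuousLinearMap (mulRightLinearMap (Fin a) ℝ M)).contDiff

theorem contDiff_transpose_mul_mul {a b : ℕ} (M : Matrix (Fin a) (Fin a) ℝ) :
    ContDiff ℝ ⊤ fun X : Matrix (Fin a) (Fin b) ℝ => Xᵀ * M * X := by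
  let β : Matrix (Fin a) (Fin b) ℝ →ₗ[ℝ] Matrix (Fin a) (Fin b) ℝ →ₗ[ℝ]
      Matrix (Fin b) (Fin b) ℝ :=
    LinearMap.mk₂ ℝ (fun X Y => Xᵀ * M * Y) (fun X X' Y => by simp [Matrix.add_mul])
      (fun c X Y => by simp) (fun X Y Y' => by simp [Matrix.mul_add]) (fun c X Y => by simp)
  have hβ : IsBoundedBilinearMap ℝ fun p : Matrix (Fin a) (Fin b) ℝ × Matrix (Fin a) (Fin b) ℝ =>
      β p.1 p.2 :=
    (LinearMap.toContinuousBilinearMap β).isBoundedBilinearMap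
  exact hβ.contDiff.comp (contDiff_id.prodMk contDiff_id)

theorem contDiffAt_costVec (hD : MemLp (fun x : Fin n → ℝ => x) 2 S.D) (hQ : S.Q.PosDef)
    (hR : S.R.PosDef) {v : Fin d × Fin m → ℝ} (h : PowStable (S.closedLoop (gainOfVec m d v))) :
    ContDiffAt ℝ ⊤ S.costVec v := by
  have hg : ContDiff ℝ ⊤ (gainOfVec m d) := (gainOfVec m d).contDiff
  have hA : ContDiff ℝ ⊤ fun w => S.closedLoop (gainOfVec m d w) :=
    contDiff_const.sub ((contDiff_mul_right S.C).comp ((contDiff_mul_left S.B).comp hg))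
  have hW : ContDiff ℝ ⊤ fun w => S.stageWeight (gainOfVec m d w) :=
    contDiff_const.add ((contDiff_transpose_mul_mul S.R).comp ((contDiff_mul_right S.C).comp hg))
  have hP := h.contDiffAt_lyap (F := fun w => S.closedLoop (gainOfVec m d w)) hA.contDiffAt
    hW.contDiffAt
  exact (S.traceX0.contDiff.contDiffAt.comp v hP).congr_of_eventuallyEq
    (costVec_eventuallyEq hD hQ hR h)

theorem hasDerivAt_vec_line {v w : Fin d × Fin m → ℝ} :
    HasDerivAt (fun t : ℝ => v + t • w) w 0 := by
  simpa using ((hasDerivAt_id (0 : ℝ)).smul_const w).const_add v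

theorem fderiv_costVec (hD : MemLp (fun x : Fin n → ℝ => x) 2 S.D) (hQ : S.Q.PosDef)
    (hR : S.R.PosDef) {v : Fin d × Fin m → ℝ} (h : PowStable (S.closedLoop (gainOfVec m d v)))
    (y : Fin d × Fin m → ℝ) :
    fderiv ℝ S.costVec v y = S.traceX0 (S.value₁ (gainOfVec m d v) (gainOfVec m d y)) := by
  have h1 : HasFDerivAt S.costVec (fderiv ℝ S.costVec v) (v + (0 : ℝ) • y) := by
    simpa using ((contDiffAt_costVec hD hQ hR h).differentiableAt (by simp)).hasFDerivAt
  have h2 := h1.comp_hasDerivAt (0 : ℝ) hasDerivAt_vec_line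
  have h3 := S.traceX0.hasFDerivAt.comp_hasDerivAt (0 : ℝ)
    (hasDerivAt_value (S := S) (K := gainOfVec m d v) (H := gainOfVec m d y) (s := 0)
      (by simpa using h))
  have hev : (S.costVec ∘ fun t : ℝ => v + t • y) =ᶠ[𝓝 0]
      (S.traceX0 ∘ fun t : ℝ => S.value (gainOfVec m d v + t • gainOfVec m d y)) := by
    have hc : Tendsto (fun t : ℝ => v + t • y) (𝓝 0) (𝓝 v) := by
      simpa using (hasDerivAt_vec_line (v := v) (w := y)).continuousAt.tendsto
    filter_upwards [hc.eventually (costVec_eventuallyEq hD hQ hR h)] with t ht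
    simpa [traceX0_apply] using ht
  have h4 := (h3.congr_of_eventuallyEq hev).unique h2
  rw [zero_smul, add_zero] at h4
  exact h4.symm

/-- The second derivative of the cost. -/
theorem fderiv_fderiv_costVec (hD : MemLp (fun x : Fin n → ℝ => x) 2 S.D) (hQ : S.Q.PosDef)
    (hR : S.R.PosDef) {v : Fin d × Fin m → ℝ} (h : PowStable (S.closedLoop (gainOfVec m d v)))
    (z y : Fin d × Fin m → ℝ) :
    fderiv ℝ (fderiv ℝ S.costVec) v z y =
      S.traceX0 (S.value₂ (gainOfVec m d v) (gainOfVec m d y) (gainOfVec m d z)) := by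
  have h0 : DifferentiableAt ℝ (fderiv ℝ S.costVec) v :=
    ((contDiffAt_costVec hD hQ hR h).fderiv_right (m := 1) le_top).differentiableAt (by simp)
  have h1 : HasFDerivAt (fun w => fderiv ℝ S.costVec w y)
      ((fderiv ℝ (fderiv ℝ S.costVec) v).flip y) v := by
    simpa using h0.hasFDerivAt.clm_apply (hasFDerivAt_const y v)
  have h2 : HasDerivAt (fun t : ℝ => fderiv ℝ S.costVec (v + t • z) y)
      ((fderiv ℝ (fderiv ℝ S.costVec) v).flip y z) 0 :=
    HasFDerivAt.comp_hasDerivAt (l := fun w => fderiv ℝ S.costVec w y)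
      (f := fun t : ℝ => v + t • z) (0 : ℝ) (by simpa using h1) hasDerivAt_vec_line
  have h3 := S.traceX0.hasFDerivAt.comp_hasDerivAt (0 : ℝ)
    (hasDerivAt_value₁ (S := S) (K := gainOfVec m d v) (H := gainOfVec m d z)
      (Z := gainOfVec m d y) (s := 0) (by simpa using h))
  have hev : (fun t : ℝ => fderiv ℝ S.costVec (v + t • z) y) =ᶠ[𝓝 0]
      (S.traceX0 ∘ fun t : ℝ =>
        S.value₁ (gainOfVec m d v + t • gainOfVec m d z) (gainOfVec m d y)) := by
    have hc : Tendsto (fun t : ℝ => v + t • z) (𝓝 0) (𝓝 v) := by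
      simpa using (hasDerivAt_vec_line (v := v) (w := z)).continuousAt.tendsto
    filter_upwards [hc.eventually (eventually_powStable_gainOfVec h)] with t ht
    simpa using fderiv_costVec hD hQ hR ht y
  have h4 := (h3.congr_of_eventuallyEq hev).unique h2
  rw [zero_smul, add_zero] at h4
  exact h4.symm

end SOFProblem

/-! ### Bounds of the value matrix and its derivatives -/

/-- A source controlled by `|x|²` and `|x| |A x|` is controlled by the identity source: along a
trajectory, `∑ |xₜ| |xₜ₊₁| ≤ ∑ |xₜ|²`. -/
theorem PowStable.abs_lyap_le_mul_lyap_one {k : ℕ} {A N : Matrix (Fin k) (Fin k) ℝ}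
    (h : PowStable A) {a b : ℝ} (hb : 0 ≤ b)
    (hN : ∀ x, |x ⬝ᵥ (N *ᵥ x)| ≤ a * vnorm x ^ 2 + 2 * b * (vnorm x * vnorm (A *ᵥ x)))
    (x : Fin k → ℝ) :
    |x ⬝ᵥ (lyap A N *ᵥ x)| ≤ (a + 2 * b) * (x ⬝ᵥ (lyap A 1 *ᵥ x)) := by
  -- the supersolution is `(a + 2b) W - b`, where `W = Aᵀ W A + 1`
  have hW : lyap A ((a + b) • (1 : Matrix (Fin k) (Fin k) ℝ) + b • (Aᵀ * 1 * A)) =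
      (a + 2 * b) • lyap A 1 - b • 1 := by
    refine h.lyap_unique ?_
    conv_lhs => rw [h.lyap_eq 1]
    simp only [Matrix.mul_sub, Matrix.sub_mul, Matrix.mul_smul, Matrix.smul_mul]
    module
  have h1 := h.abs_lyap_le (M := N)
    (N := (a + b) • (1 : Matrix (Fin k) (Fin k) ℝ) + b • (Aᵀ * 1 * A)) (fun y => by
      rw [add_mulVec, dotProduct_add, smul_mulVec, smul_mulVec, dotProduct_smul, dotProduct_smul,
        dotProduct_transpose_mul_mulVec, one_mulVec, one_mulVec, ← vnorm_sq, ← vnorm_sq,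
        smul_eq_mul, smul_eq_mul]
      have h2 := hN y
      have h3 := mul_nonneg hb (sq_nonneg (vnorm y - vnorm (A *ᵥ y)))
      linarith) x
  rw [hW, sub_mulVec, dotProduct_sub, smul_mulVec, smul_mulVec, dotProduct_smul, dotProduct_smul,
    one_mulVec, ← vnorm_sq, smul_eq_mul, smul_eq_mul] at h1
  linarith [mul_nonneg hb (sq_nonneg (vnorm x))]

theorem quadForm_le_specNorm {k : ℕ} (X : Matrix (Fin k) (Fin k) ℝ) (x : Fin k → ℝ) :
    |x ⬝ᵥ (X *ᵥ x)| ≤ specNorm X * vnorm x ^ 2 := by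
  calc _ ≤ vnorm x * vnorm (X *ᵥ x) := abs_dotProduct_le _ _
    _ ≤ vnorm x * (specNorm X * vnorm x) := by
      gcongr
      · exact vnorm_nonneg x
      · exact vnorm_mulVec_le X x
    _ = _ := by ring

/-- Young's inequality with weight `e`, where `e = 0` is allowed. -/
theorem two_abs_bilinForm_le_of_sq {k : ℕ} {X : Matrix (Fin k) (Fin k) ℝ} (hX : X.PosSemidef)
    {e s : ℝ} (he : 0 ≤ e) (u v : Fin k → ℝ) (hu : u ⬝ᵥ (X *ᵥ u) ≤ e ^ 2 * s) :
    2 * |u ⬝ᵥ (X *ᵥ v)| ≤ e * (s + v ⬝ᵥ (X *ᵥ v)) := by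
  rcases he.eq_or_lt with rfl | he
  · have h0 : u ⬝ᵥ (X *ᵥ u) = 0 := le_antisymm (by simpa using hu) (quadForm_nonneg hX u)
    have h1 : X *ᵥ u = 0 := (hX.dotProduct_mulVec_zero_iff u).1 (by simpa using h0)
    rw [dotProduct_mulVec, ← mulVec_transpose, transpose_eq_of_posSemidef hX, h1]
    simp
  · refine (two_abs_bilinForm_le hX he u v).trans ?_
    rw [mul_add]
    gcongr
    rw [div_le_iff₀ he]
    linarith

namespace SOFProblem

variable {n m d : ℕ} {S : SOFProblem n m d} {K Z Y H : Matrix (Fin m) (Fin d) ℝ} {z y h : ℝ}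

theorem vnorm_mul_C_le (hz : specNorm Z ≤ z) (x : Fin n → ℝ) :
    vnorm ((Z * S.C) *ᵥ x) ≤ z * specNorm S.C * vnorm x := by
  rw [← mulVec_mulVec, mul_assoc]
  exact (vnorm_mulVec_le _ _).trans (mul_le_mul hz (vnorm_mulVec_le _ _) (vnorm_nonneg _)
    ((specNorm_nonneg _).trans hz))

theorem vnorm_loopDir_le (hz : specNorm Z ≤ z) (x : Fin n → ℝ) :
    vnorm (S.loopDir Z *ᵥ x) ≤ z * (specNorm S.B * specNorm S.C) * vnorm x := by
  have e : vnorm (S.loopDir Z *ᵥ x) = vnorm (S.B *ᵥ ((Z * S.C) *ᵥ x)) := by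
    rw [loopDir, neg_mulVec, mulVec_mulVec, ← Matrix.mul_assoc]
    simpa using vnorm_smul (-1) ((S.B * Z * S.C) *ᵥ x)
  rw [e]
  calc _ ≤ specNorm S.B * (z * specNorm S.C * vnorm x) :=
        (vnorm_mulVec_le _ _).trans
          (mul_le_mul_of_nonneg_left (vnorm_mul_C_le hz x) (specNorm_nonneg _))
    _ = _ := by ring

theorem quadForm_mul_C_le (hz : specNorm Z ≤ z) (x : Fin n → ℝ) :
    ((Z * S.C) *ᵥ x) ⬝ᵥ (S.R *ᵥ ((Z * S.C) *ᵥ x)) ≤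
      z ^ 2 * (specNorm S.R * specNorm S.C ^ 2) * vnorm x ^ 2 := by
  refine (le_abs_self _).trans ((quadForm_le_specNorm _ _).trans ?_)
  calc _ ≤ specNorm S.R * (z * specNorm S.C * vnorm x) ^ 2 := by
        gcongr
        · exact specNorm_nonneg _
        · exact vnorm_nonneg _
        · exact vnorm_mul_C_le hz x
    _ = _ := by ring

/-- A cross term with a symmetric middle factor. -/
theorem abs_crossForm_loopDir_le {X : Matrix (Fin n) (Fin n) ℝ} (hX : Xᵀ = X) {ξ : ℝ} (hξ : 0 ≤ ξ)
    (hXle : ∀ x, |x ⬝ᵥ (X *ᵥ x)| ≤ ξ * vnorm x ^ 2) (hz : specNorm Z ≤ z)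
    (V : Matrix (Fin n) (Fin n) ℝ) (x : Fin n → ℝ) :
    |x ⬝ᵥ (crossForm (S.loopDir Z) X V *ᵥ x)| ≤
      2 * (z * (specNorm S.B * specNorm S.C) * ξ) * (vnorm x * vnorm (V *ᵥ x)) := by
  rw [quadForm_crossForm hX, abs_mul, abs_two]
  have h1 := abs_bilinForm_le hX hXle (S.loopDir Z *ᵥ x) (V *ᵥ x)
  calc _ ≤ 2 * (ξ * (vnorm (S.loopDir Z *ᵥ x) * vnorm (V *ᵥ x))) := by gcongr
    _ ≤ 2 * (ξ * (z * (specNorm S.B * specNorm S.C) * vnorm x * vnorm (V *ᵥ x))) := by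
        gcongr
        · exact vnorm_nonneg _
        · exact vnorm_loopDir_le hz x
    _ = _ := by ring

theorem transpose_stageWeight (hQ : S.Q.PosDef) (hR : S.R.PosDef) :
    (S.stageWeight K)ᵀ = S.stageWeight K := by
  rw [stageWeight, transpose_add, transpose_eq_of_posSemidef hQ.posSemidef]
  simp [Matrix.mul_assoc, transpose_eq_of_posSemidef hR.posSemidef]

theorem value_posSemidef (hQ : S.Q.PosDef) (hR : S.R.PosDef)
    (hK : PowStable (S.closedLoop K)) : (S.value K).PosSemidef := by
  refine PosSemidef.of_dotProduct_mulVec_nonneg ?_ fun x => ?_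
  · rw [IsHermitian, conjTranspose_eq_transpose_of_trivial]
    exact hK.lyap_transpose (transpose_stageWeight hQ hR)
  · simpa [value] using hK.lyap_nonneg (stageWeight_quadForm_nonneg hQ hR) x

/-- The data available at a gain `K` of a sublevel set: stability, a bound `p` of the value matrix
and a bound `g` of the closed-loop matrix. -/
structure GainBounds (S : SOFProblem n m d) (K : Matrix (Fin m) (Fin d) ℝ) (p g : ℝ) : Prop where
  n_pos : 0 < n
  Q_posDef : S.Q.PosDef
  R_posDef : S.R.PosDef
  stable : PowStable (S.closedLoop K)
  value_le : ∀ x, x ⬝ᵥ (S.value K *ᵥ x) ≤ p * vnorm x ^ 2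
  loop_le : ∀ x, vnorm (S.closedLoop K *ᵥ x) ≤ g * vnorm x

/-- The growth rate `min ζ₁ (2 κ β min (1, g) + √ρ)` of the value matrix, relative to itself, per
unit of the gain; here `κ = p / σ_min(Q)`, `β = ‖B‖ ‖C‖` and `ρ = ‖R‖ ‖C‖² / σ_min(Q)`. -/
def valueRate (S : SOFProblem n m d) (p g : ℝ) : ℝ :=
  min (1 / sigmaMin S.Q *
      (p * (1 + specNorm S.B ^ 2 * specNorm S.C ^ 2) + specNorm S.R * specNorm S.C ^ 2) - 1)
    (2 * (p / sigmaMin S.Q) * (specNorm S.B * specNorm S.C) * min 1 g +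
      √(specNorm S.R * specNorm S.C ^ 2 / sigmaMin S.Q))

/-- The bound of the second derivative of the value matrix per unit of the two directions. -/
def valueRate₂ (S : SOFProblem n m d) (p g : ℝ) : ℝ :=
  (4 * (specNorm S.B * specNorm S.C) * g * (S.valueRate p g * p) +
    2 * (specNorm S.B * specNorm S.C) ^ 2 * p + 2 * specNorm S.R * specNorm S.C ^ 2) *
    (p / sigmaMin S.Q)

namespace GainBounds

variable {p g : ℝ} (hb : S.GainBounds K p g)
include hb

theorem sigmaMin_Q_pos : 0 < sigmaMin S.Q := sigmaMin_pos hb.n_pos hb.Q_posDef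

theorem value_posSemidef : (S.value K).PosSemidef :=
  SOFProblem.value_posSemidef hb.Q_posDef hb.R_posDef hb.stable

theorem transpose_value : (S.value K)ᵀ = S.value K :=
  transpose_eq_of_posSemidef hb.value_posSemidef

theorem value_nonneg (x : Fin n → ℝ) : 0 ≤ x ⬝ᵥ (S.value K *ᵥ x) :=
  quadForm_nonneg hb.value_posSemidef x

theorem abs_value_le (x : Fin n → ℝ) : |x ⬝ᵥ (S.value K *ᵥ x)| ≤ p * vnorm x ^ 2 := by
  rw [abs_of_nonneg (hb.value_nonneg x)]
  exact hb.value_le x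

theorem sigmaMin_mul_sq_le_stageWeight (x : Fin n → ℝ) :
    sigmaMin S.Q * vnorm x ^ 2 ≤ x ⬝ᵥ (S.stageWeight K *ᵥ x) := by
  rw [quadForm_stageWeight]
  linarith [sigmaMin_mul_sq_le hb.Q_posDef x,
    quadForm_nonneg hb.R_posDef.posSemidef ((K * S.C) *ᵥ x)]

theorem lyap_one_le (x : Fin n → ℝ) :
    x ⬝ᵥ (lyap (S.closedLoop K) 1 *ᵥ x) ≤ x ⬝ᵥ (S.value K *ᵥ x) / sigmaMin S.Q := by
  have h1 := hb.stable.lyap_mono (M := sigmaMin S.Q • 1) (N := S.stageWeight K) (fun y => by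
    rw [smul_mulVec, dotProduct_smul, one_mulVec, ← vnorm_sq]
    exact hb.sigmaMin_mul_sq_le_stageWeight y) x
  rw [lyap_smul, smul_mulVec, dotProduct_smul, smul_eq_mul] at h1
  rw [le_div_iff₀ hb.sigmaMin_Q_pos, mul_comm]
  exact h1

theorem sigmaMin_Q_le : sigmaMin S.Q ≤ p := by
  have h1 := hb.sigmaMin_mul_sq_le_stageWeight (Pi.single ⟨0, hb.n_pos⟩ 1)
  have h2 := hb.stable.lyap_quadForm (S.stageWeight K) (Pi.single ⟨0, hb.n_pos⟩ 1)
  have h3 := hb.value_le (Pi.single ⟨0, hb.n_pos⟩ 1)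
  have h4 := hb.value_nonneg (S.closedLoop K *ᵥ (Pi.single ⟨0, hb.n_pos⟩ 1))
  rw [vnorm_single] at h1 h3
  rw [value] at h3 h4
  linarith

theorem p_pos : 0 < p := hb.sigmaMin_Q_pos.trans_le hb.sigmaMin_Q_le

theorem loop_nonneg : 0 ≤ g := by
  have := hb.loop_le (Pi.single ⟨0, hb.n_pos⟩ 1)
  rw [vnorm_single, mul_one] at this
  exact (vnorm_nonneg _).trans this

theorem lyap_one_le_mul_sq (x : Fin n → ℝ) :
    x ⬝ᵥ (lyap (S.closedLoop K) 1 *ᵥ x) ≤ p / sigmaMin S.Q * vnorm x ^ 2 := by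
  refine (hb.lyap_one_le x).trans ?_
  rw [div_mul_eq_mul_div]
  exact div_le_div_of_nonneg_right (hb.value_le x) hb.sigmaMin_Q_pos.le

theorem zeta_nonneg : 0 ≤ 1 / sigmaMin S.Q *
    (p * (1 + specNorm S.B ^ 2 * specNorm S.C ^ 2) + specNorm S.R * specNorm S.C ^ 2) - 1 := by
  have hq := hb.sigmaMin_Q_pos
  have hp := hb.p_pos
  have hr := specNorm_nonneg S.R
  rw [sub_nonneg, one_div, ← div_eq_inv_mul, le_div_iff₀ hq, one_mul]
  have : 0 ≤ p * (specNorm S.B ^ 2 * specNorm S.C ^ 2) + specNorm S.R * specNorm S.C ^ 2 := by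
    positivity
  linarith [hb.sigmaMin_Q_le]

theorem valueRate_nonneg : 0 ≤ S.valueRate p g := by
  have hq := hb.sigmaMin_Q_pos
  have hp := hb.p_pos
  have hg := hb.loop_nonneg
  have hB := specNorm_nonneg S.B
  have hC := specNorm_nonneg S.C
  exact le_min hb.zeta_nonneg (by positivity)

theorem transpose_source₁ : (S.source₁ K Z)ᵀ = S.source₁ K Z := by
  rw [source₁, transpose_add, crossForm_transpose hb.transpose_value,
    crossForm_transpose (transpose_eq_of_posSemidef hb.R_posDef.posSemidef)]

theorem transpose_value₁ : (S.value₁ K Z)ᵀ = S.value₁ K Z :=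
  hb.stable.lyap_transpose hb.transpose_source₁

theorem transpose_value₂ : (S.value₂ K Z Y)ᵀ = S.value₂ K Z Y :=
  hb.stable.lyap_transpose (by
    simp only [source₂, transpose_add, crossForm_transpose hb.transpose_value,
      crossForm_transpose hb.transpose_value₁,
      crossForm_transpose (transpose_eq_of_posSemidef hb.R_posDef.posSemidef)])

/-- The first bound of the source of `value₁`, by Young's inequality applied to the form
`(u, v) ↦ uᵀ P v` on states plus `(u, v) ↦ uᵀ R v` on inputs. -/
theorem abs_source₁_le (hz0 : 0 < z) (hz : specNorm Z ≤ z) (x : Fin n → ℝ) :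
    |x ⬝ᵥ (S.source₁ K Z *ᵥ x)| ≤ z * (1 / sigmaMin S.Q *
      (p * (1 + specNorm S.B ^ 2 * specNorm S.C ^ 2) + specNorm S.R * specNorm S.C ^ 2) - 1) *
      (x ⬝ᵥ (S.stageWeight K *ᵥ x)) := by
  have hq := hb.sigmaMin_Q_pos
  have hRs := hb.R_posDef.posSemidef
  have hzeta := hb.zeta_nonneg
  set s := p * (1 + specNorm S.B ^ 2 * specNorm S.C ^ 2) + specNorm S.R * specNorm S.C ^ 2 with hs
  have hs0 : 0 ≤ s := by
    have := hb.p_pos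
    have := specNorm_nonneg S.R
    positivity
  rw [source₁, add_mulVec, dotProduct_add, quadForm_crossForm hb.transpose_value,
    quadForm_crossForm (transpose_eq_of_posSemidef hRs)]
  have h1 := two_abs_bilinForm_le hb.value_posSemidef hz0 (S.loopDir Z *ᵥ x) (S.closedLoop K *ᵥ x)
  have h2 := two_abs_bilinForm_le hRs hz0 ((Z * S.C) *ᵥ x) ((K * S.C) *ᵥ x)
  have h3 : (S.loopDir Z *ᵥ x) ⬝ᵥ (S.value K *ᵥ (S.loopDir Z *ᵥ x)) / z ≤
      z * (p * (specNorm S.B ^ 2 * specNorm S.C ^ 2)) * vnorm x ^ 2 := by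
    rw [div_le_iff₀ hz0]
    refine (hb.value_le _).trans ?_
    calc _ ≤ p * (z * (specNorm S.B * specNorm S.C) * vnorm x) ^ 2 := by
          gcongr
          · exact hb.p_pos.le
          · exact vnorm_nonneg _
          · exact vnorm_loopDir_le hz x
      _ = _ := by ring
  have h4 : ((Z * S.C) *ᵥ x) ⬝ᵥ (S.R *ᵥ ((Z * S.C) *ᵥ x)) / z ≤
      z * (specNorm S.R * specNorm S.C ^ 2) * vnorm x ^ 2 := by
    rw [div_le_iff₀ hz0]
    refine (quadForm_mul_C_le hz x).trans (le_of_eq (by ring))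
  -- `P - Q` is the sum of the two forms at the closed loop
  have h5 := hb.stable.lyap_quadForm (S.stageWeight K) x
  have h5' := quadForm_stageWeight S K x
  have h6 : (S.closedLoop K *ᵥ x) ⬝ᵥ (S.value K *ᵥ (S.closedLoop K *ᵥ x)) +
      ((K * S.C) *ᵥ x) ⬝ᵥ (S.R *ᵥ ((K * S.C) *ᵥ x)) ≤ p * vnorm x ^ 2 - x ⬝ᵥ (S.Q *ᵥ x) := by
    have := hb.value_le x
    rw [value] at this ⊢
    linarith
  have h7 : vnorm x ^ 2 ≤ 1 / sigmaMin S.Q * (x ⬝ᵥ (S.Q *ᵥ x)) := by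
    rw [one_div, ← div_eq_inv_mul, le_div_iff₀ hq, mul_comm]
    exact sigmaMin_mul_sq_le hb.Q_posDef x
  have h8 : x ⬝ᵥ (S.Q *ᵥ x) ≤ x ⬝ᵥ (S.stageWeight K *ᵥ x) := by
    linarith [quadForm_nonneg hRs ((K * S.C) *ᵥ x)]
  have h9 := mul_le_mul_of_nonneg_left h6 hz0.le
  have h10 := mul_le_mul_of_nonneg_left (mul_le_mul_of_nonneg_left h7 hs0) hz0.le
  have h11 := mul_le_mul_of_nonneg_left h8 (mul_nonneg hz0.le hzeta)
  calc _ ≤ 2 * |(S.loopDir Z *ᵥ x) ⬝ᵥ (S.value K *ᵥ (S.closedLoop K *ᵥ x))| +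
        2 * |((Z * S.C) *ᵥ x) ⬝ᵥ (S.R *ᵥ ((K * S.C) *ᵥ x))| := by
        refine (abs_add_le _ _).trans (le_of_eq ?_)
        rw [abs_mul, abs_mul, abs_two]
    _ ≤ z * (s * vnorm x ^ 2) - z * (x ⬝ᵥ (S.Q *ᵥ x)) := by
        rw [hs]
        linarith
    _ ≤ z * (1 / sigmaMin S.Q * s - 1) * (x ⬝ᵥ (S.Q *ᵥ x)) := by linarith
    _ ≤ _ := h11

/-- The second bound of `value₁`, which separates the variation of the state from that of the
input. -/
theorem abs_value₁_le_of_split (hz0 : 0 ≤ z) (hz : specNorm Z ≤ z) (x : Fin n → ℝ) :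
    |x ⬝ᵥ (S.value₁ K Z *ᵥ x)| ≤
      z * (2 * (p / sigmaMin S.Q) * (specNorm S.B * specNorm S.C) * min 1 g +
        √(specNorm S.R * specNorm S.C ^ 2 / sigmaMin S.Q)) * (x ⬝ᵥ (S.value K *ᵥ x)) := by
  have hq := hb.sigmaMin_Q_pos
  have hp := hb.p_pos
  have hg := hb.loop_nonneg
  have hB := specNorm_nonneg S.B
  have hC := specNorm_nonneg S.C
  have hR := specNorm_nonneg S.R
  have hRs := hb.R_posDef.posSemidef
  set β := specNorm S.B * specNorm S.C with hβ
  have hβ0 : 0 ≤ β := by positivity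
  have hcross := abs_crossForm_loopDir_le (S := S) hb.transpose_value hp.le hb.abs_value_le hz
    (S.closedLoop K)
  have h1 : |x ⬝ᵥ (lyap (S.closedLoop K)
      (crossForm (S.loopDir Z) (S.value K) (S.closedLoop K)) *ᵥ x)| ≤
      2 * (z * β * p) * min 1 g * (x ⬝ᵥ (lyap (S.closedLoop K) 1 *ᵥ x)) := by
    rcases min_cases 1 g with ⟨e, _⟩ | ⟨e, _⟩ <;> rw [e]
    · have := hb.stable.abs_lyap_le_mul_lyap_one (a := 0) (b := z * β * p) (by positivity)
        (fun y => by rw [zero_mul, zero_add]; exact hcross y) x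
      simpa using this
    · have := hb.stable.abs_lyap_le_mul_lyap_one (a := 2 * (z * β * p) * g) (b := 0) le_rfl
        (N := crossForm (S.loopDir Z) (S.value K) (S.closedLoop K))
        (fun y => (hcross y).trans (by
          have := mul_le_mul_of_nonneg_left (hb.loop_le y) (vnorm_nonneg y)
          have h2 : 0 ≤ 2 * (z * β * p) := by positivity
          have := mul_le_mul_of_nonneg_left this h2
          linarith)) x
      simpa using this
  have h2 : |x ⬝ᵥ (lyap (S.closedLoop K) (crossForm (Z * S.C) S.R (K * S.C)) *ᵥ x)| ≤
      z * √(specNorm S.R * specNorm S.C ^ 2 / sigmaMin S.Q) * (x ⬝ᵥ (S.value K *ᵥ x)) := by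
    have h3 := hb.stable.abs_lyap_le (M := crossForm (Z * S.C) S.R (K * S.C))
      (N := (z * √(specNorm S.R * specNorm S.C ^ 2 / sigmaMin S.Q)) • S.stageWeight K)
      (fun y => by
        rw [quadForm_crossForm (transpose_eq_of_posSemidef hRs), abs_mul, abs_two, smul_mulVec,
          dotProduct_smul, smul_eq_mul, quadForm_stageWeight]
        refine two_abs_bilinForm_le_of_sq hRs (by positivity) _ _ ?_
        refine (quadForm_mul_C_le hz y).trans ?_
        rw [mul_pow, Real.sq_sqrt (by positivity), mul_assoc, mul_assoc (z ^ 2),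
          div_mul_eq_mul_div, mul_div_assoc]
        gcongr
        rw [le_div_iff₀ hq, mul_comm]
        exact sigmaMin_mul_sq_le hb.Q_posDef y) x
    rwa [lyap_smul, smul_mulVec, dotProduct_smul, smul_eq_mul] at h3
  have h4 : 2 * (z * β * p) * min 1 g * (x ⬝ᵥ (lyap (S.closedLoop K) 1 *ᵥ x)) ≤
      2 * (z * β * p) * min 1 g * (x ⬝ᵥ (S.value K *ᵥ x) / sigmaMin S.Q) :=
    mul_le_mul_of_nonneg_left (hb.lyap_one_le x) (by positivity)
  rw [value₁, source₁, lyap_add, add_mulVec, dotProduct_add]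
  refine (abs_add_le _ _).trans ((add_le_add (h1.trans h4) h2).trans (le_of_eq ?_))
  ring

theorem abs_value₁_le (hz0 : 0 < z) (hz : specNorm Z ≤ z) (x : Fin n → ℝ) :
    |x ⬝ᵥ (S.value₁ K Z *ᵥ x)| ≤ z * (S.valueRate p g * p) * vnorm x ^ 2 := by
  have h1 : |x ⬝ᵥ (S.value₁ K Z *ᵥ x)| ≤ z * S.valueRate p g * (x ⬝ᵥ (S.value K *ᵥ x)) := by
    rw [valueRate]
    rcases min_cases (1 / sigmaMin S.Q * (p * (1 + specNorm S.B ^ 2 * specNorm S.C ^ 2) +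
        specNorm S.R * specNorm S.C ^ 2) - 1)
      (2 * (p / sigmaMin S.Q) * (specNorm S.B * specNorm S.C) * min 1 g +
        √(specNorm S.R * specNorm S.C ^ 2 / sigmaMin S.Q)) with ⟨e, _⟩ | ⟨e, _⟩ <;> rw [e]
    · have h2 := hb.stable.abs_lyap_le (M := S.source₁ K Z) (N := (z * (1 / sigmaMin S.Q *
        (p * (1 + specNorm S.B ^ 2 * specNorm S.C ^ 2) +
        specNorm S.R * specNorm S.C ^ 2) - 1)) • S.stageWeight K) (fun y => by
          rw [smul_mulVec, dotProduct_smul, smul_eq_mul]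
          exact hb.abs_source₁_le hz0 hz y) x
      rwa [lyap_smul, smul_mulVec, dotProduct_smul, smul_eq_mul] at h2
    · exact hb.abs_value₁_le_of_split hz0.le hz x
  refine h1.trans ?_
  have h2 := mul_le_mul_of_nonneg_left (hb.value_le x) (mul_nonneg hz0.le hb.valueRate_nonneg)
  linarith

theorem valueRate₂_nonneg : 0 ≤ S.valueRate₂ p g := by
  have hq := hb.sigmaMin_Q_pos
  have hp := hb.p_pos
  have hg := hb.loop_nonneg
  have hB := specNorm_nonneg S.B
  have hC := specNorm_nonneg S.C
  have hR := specNorm_nonneg S.R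
  have := hb.valueRate_nonneg
  rw [valueRate₂]
  positivity

theorem abs_value₂_le (hz0 : 0 < z) (hz : specNorm Z ≤ z) (hy0 : 0 < y) (hy : specNorm Y ≤ y)
    (x : Fin n → ℝ) :
    |x ⬝ᵥ (S.value₂ K Z Y *ᵥ x)| ≤ z * y * S.valueRate₂ p g * vnorm x ^ 2 := by
  have hq := hb.sigmaMin_Q_pos
  have hp := hb.p_pos
  have hg := hb.loop_nonneg
  have hB := specNorm_nonneg S.B
  have hC := specNorm_nonneg S.C
  have hR := specNorm_nonneg S.R
  have hζ := hb.valueRate_nonneg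
  have hRs := hb.R_posDef.posSemidef
  set β := specNorm S.B * specNorm S.C with hβ
  set ξ := S.valueRate p g * p with hξ
  have hβ0 : 0 ≤ β := by positivity
  have hξ0 : 0 ≤ ξ := by positivity
  set a := z * y * (4 * β * g * ξ + 2 * β ^ 2 * p + 2 * specNorm S.R * specNorm S.C ^ 2) with ha
  have hN : ∀ x, |x ⬝ᵥ (S.source₂ K Z Y *ᵥ x)| ≤ a * vnorm x ^ 2 + 2 * 0 *
      (vnorm x * vnorm (S.closedLoop K *ᵥ x)) := by
    intro x
    have hx := vnorm_nonneg x
    have h1 := abs_crossForm_loopDir_le (S := S) hb.transpose_value₁ (by positivity)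
      (hb.abs_value₁_le hy0 hy) hz (S.closedLoop K) x
    have h2 := abs_crossForm_loopDir_le (S := S) hb.transpose_value₁ (by positivity)
      (hb.abs_value₁_le hz0 hz) hy (S.closedLoop K) x
    have h3 := abs_crossForm_loopDir_le (S := S) hb.transpose_value hp.le hb.abs_value_le hz
      (S.loopDir Y) x
    have h4 : |x ⬝ᵥ (crossForm (Z * S.C) S.R (Y * S.C) *ᵥ x)| ≤
        z * y * (2 * specNorm S.R * specNorm S.C ^ 2) * vnorm x ^ 2 := by
      rw [quadForm_crossForm (transpose_eq_of_posSemidef hRs), abs_mul, abs_two]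
      calc _ ≤ 2 * (specNorm S.R * (vnorm ((Z * S.C) *ᵥ x) * vnorm ((Y * S.C) *ᵥ x))) := by
            gcongr
            exact abs_bilinForm_le (transpose_eq_of_posSemidef hRs) (quadForm_le_specNorm S.R) _ _
        _ ≤ 2 * (specNorm S.R * (z * specNorm S.C * vnorm x * (y * specNorm S.C * vnorm x))) := by
            gcongr
            · exact vnorm_nonneg _
            · exact vnorm_mul_C_le hz x
            · exact vnorm_mul_C_le hy x
        _ = _ := by ring
    have h5 := mul_le_mul_of_nonneg_left (mul_le_mul_of_nonneg_left (hb.loop_le x) hx)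
      (show 0 ≤ 2 * (z * β * (y * ξ)) by positivity)
    have h6 := mul_le_mul_of_nonneg_left (mul_le_mul_of_nonneg_left
      (vnorm_loopDir_le (S := S) hy x) hx) (show 0 ≤ 2 * (z * β * p) by positivity)
    rw [source₂]
    simp only [add_mulVec, dotProduct_add]
    refine (abs_add_le _ _).trans ((add_le_add (abs_add_three _ _ _) le_rfl).trans ?_)
    rw [ha]
    linarith
  refine (hb.stable.abs_lyap_le_mul_lyap_one le_rfl hN x).trans ?_
  have ha0 : 0 ≤ a := by positivity
  have h7 := mul_le_mul_of_nonneg_left (hb.lyap_one_le_mul_sq x) ha0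
  rw [valueRate₂, ← hβ, ← hξ]
  linarith

theorem abs_source₃_le (hz0 : 0 < z) (hz : specNorm Z ≤ z) (hy0 : 0 < y) (hy : specNorm Y ≤ y)
    (hh0 : 0 < h) (hh : specNorm H ≤ h) (x : Fin n → ℝ) :
    |x ⬝ᵥ (S.source₃ K Z Y H *ᵥ x)| ≤
      z * y * h * (6 * (specNorm S.B * specNorm S.C) ^ 2 * (S.valueRate p g * p)) * vnorm x ^ 2 +
      2 * (z * y * h * (3 * (specNorm S.B * specNorm S.C) * S.valueRate₂ p g)) *
        (vnorm x * vnorm (S.closedLoop K *ᵥ x)) := by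
  have hp := hb.p_pos
  have hB := specNorm_nonneg S.B
  have hC := specNorm_nonneg S.C
  have hζ := hb.valueRate_nonneg
  have hφ := hb.valueRate₂_nonneg
  set β := specNorm S.B * specNorm S.C with hβ
  set ξ := S.valueRate p g * p with hξ
  have hβ0 : 0 ≤ β := by positivity
  have hξ0 : 0 ≤ ξ := by positivity
  have hx := vnorm_nonneg x
  have h1 := abs_crossForm_loopDir_le (S := S) hb.transpose_value₂ (by positivity)
    (hb.abs_value₂_le hy0 hy hh0 hh) hz (S.closedLoop K) x
  have h2 := abs_crossForm_loopDir_le (S := S) hb.transpose_value₂ (by positivity)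
    (hb.abs_value₂_le hz0 hz hh0 hh) hy (S.closedLoop K) x
  have h3 := abs_crossForm_loopDir_le (S := S) hb.transpose_value₂ (by positivity)
    (hb.abs_value₂_le hz0 hz hy0 hy) hh (S.closedLoop K) x
  have h4 := abs_crossForm_loopDir_le (S := S) hb.transpose_value₁ (by positivity)
    (hb.abs_value₁_le hy0 hy) hz (S.loopDir H) x
  have h5 := abs_crossForm_loopDir_le (S := S) hb.transpose_value₁ (by positivity)
    (hb.abs_value₁_le hz0 hz) hy (S.loopDir H) x
  have h6 := abs_crossForm_loopDir_le (S := S) hb.transpose_value₁ (by positivity)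
    (hb.abs_value₁_le hh0 hh) hz (S.loopDir Y) x
  have k4 := mul_le_mul_of_nonneg_left (mul_le_mul_of_nonneg_left
    (vnorm_loopDir_le (S := S) hh x) hx) (show 0 ≤ 2 * (z * β * (y * ξ)) by positivity)
  have k5 := mul_le_mul_of_nonneg_left (mul_le_mul_of_nonneg_left
    (vnorm_loopDir_le (S := S) hh x) hx) (show 0 ≤ 2 * (y * β * (z * ξ)) by positivity)
  have k6 := mul_le_mul_of_nonneg_left (mul_le_mul_of_nonneg_left
    (vnorm_loopDir_le (S := S) hy x) hx) (show 0 ≤ 2 * (z * β * (h * ξ)) by positivity)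
  rw [source₃]
  simp only [add_mulVec, dotProduct_add]
  refine (abs_add_le _ _).trans ((add_le_add ((abs_add_le _ _).trans (add_le_add
    ((abs_add_le _ _).trans (add_le_add (abs_add_three _ _ _) le_rfl)) le_rfl)) le_rfl).trans ?_)
  linarith

/-- The third derivative of the cost at `K` along three directions. -/
theorem abs_traceX0_value₃_le (hD : MemLp (fun x : Fin n → ℝ => x) 2 S.D) (hz0 : 0 < z)
    (hz : specNorm Z ≤ z) (hy0 : 0 < y) (hy : specNorm Y ≤ y) (hh0 : 0 < h)
    (hh : specNorm H ≤ h) :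
    |S.traceX0 (S.value₃ K Z Y H)| ≤ z * y * h *
      (6 * (specNorm S.B * specNorm S.C) ^ 2 * (S.valueRate p g * p) +
        6 * (specNorm S.B * specNorm S.C) * S.valueRate₂ p g) *
      (S.traceX0 (S.value K) / sigmaMin S.Q) := by
  have hq := hb.sigmaMin_Q_pos
  have hp := hb.p_pos
  have hB := specNorm_nonneg S.B
  have hC := specNorm_nonneg S.C
  have hζ := hb.valueRate_nonneg
  have hφ := hb.valueRate₂_nonneg
  set β := specNorm S.B * specNorm S.C with hβ
  set ξ := S.valueRate p g * p with hξ
  have hβ0 : 0 ≤ β := by positivity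
  set c := z * y * h * (6 * β ^ 2 * ξ + 6 * β * S.valueRate₂ p g) with hc
  have hc0 : 0 ≤ c := by positivity
  have h1 : ∀ x, |x ⬝ᵥ (S.value₃ K Z Y H *ᵥ x)| ≤
      x ⬝ᵥ (((c / sigmaMin S.Q) • S.value K) *ᵥ x) := by
    intro x
    have h2 := hb.stable.abs_lyap_le_mul_lyap_one (by positivity)
      (hb.abs_source₃_le hz0 hz hy0 hy hh0 hh) x
    have h3 := mul_le_mul_of_nonneg_left (hb.lyap_one_le x) hc0
    rw [smul_mulVec, dotProduct_smul, smul_eq_mul, value₃]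
    calc _ ≤ c * (x ⬝ᵥ (lyap (S.closedLoop K) 1 *ᵥ x)) := by
          refine h2.trans (le_of_eq ?_)
          rw [hc]
          ring
      _ ≤ _ := h3
      _ = _ := by ring
  have h4 : S.traceX0 (S.value₃ K Z Y H) ≤ S.traceX0 ((c / sigmaMin S.Q) • S.value K) :=
    trace_X0_mono hD fun x => (abs_le'.1 (h1 x)).1
  have h5 : S.traceX0 (-S.value₃ K Z Y H) ≤ S.traceX0 ((c / sigmaMin S.Q) • S.value K) :=
    trace_X0_mono hD fun x => by
      rw [neg_mulVec, dotProduct_neg]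
      exact (abs_le'.1 (h1 x)).2
  rw [map_neg] at h5
  refine (abs_le'.2 ⟨h4, h5⟩).trans (le_of_eq ?_)
  rw [map_smul, smul_eq_mul]
  ring

end GainBounds

end SOFProblem

/-! ### Sublevel sets -/

theorem specNorm_eq_norm {a b : ℕ} (M : Matrix (Fin a) (Fin b) ℝ) : specNorm M = ‖M‖ := rfl

theorem continuous_specNorm {a b : ℕ} :
    Continuous (specNorm : Matrix (Fin a) (Fin b) ℝ → ℝ) := by
  have : (specNorm : Matrix (Fin a) (Fin b) ℝ → ℝ) = fun M => ‖M‖ := funext specNorm_eq_norm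
  rw [this]
  exact continuous_norm

theorem isCompact_matrix_box {a b : ℕ} (c : ℝ) :
    IsCompact {M : Matrix (Fin a) (Fin b) ℝ | ∀ i j, |M i j| ≤ c} := by
  have h : IsCompact (Set.univ.pi fun _ : Fin a => Set.univ.pi fun _ : Fin b => Set.Icc (-c) c) :=
    isCompact_univ_pi fun _ => isCompact_univ_pi fun _ => isCompact_Icc
  convert! h using 1
  ext M
  exact ⟨fun h i _ j _ => abs_le.1 (h i j), fun h i j => abs_le.2 (h i trivial j trivial)⟩

theorem abs_entry_le {a b : ℕ} (M : Matrix (Fin a) (Fin b) ℝ) (i : Fin a) (j : Fin b) :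
    |M i j| ≤ vnorm (M *ᵥ Pi.single j 1) := by
  have := abs_dotProduct_le (Pi.single i 1) (M *ᵥ Pi.single j 1)
  rw [vnorm_single, one_mul] at this
  simpa using this

theorem sq_bilinForm_le {k : ℕ} {X : Matrix (Fin k) (Fin k) ℝ} (hX : X.PosSemidef)
    (x y : Fin k → ℝ) : (x ⬝ᵥ (X *ᵥ y)) ^ 2 ≤ y ⬝ᵥ (X *ᵥ y) * (x ⬝ᵥ (X *ᵥ x)) := by
  have h := discrim_le_zero (a := y ⬝ᵥ (X *ᵥ y)) (b := 2 * (x ⬝ᵥ (X *ᵥ y)))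
    (c := x ⬝ᵥ (X *ᵥ x)) fun s => by
      have := quadForm_nonneg hX (x + s • y)
      rw [quadForm_add_smul (transpose_eq_of_posSemidef hX)] at this
      linarith
  rw [discrim] at h
  linarith

namespace SOFProblem

variable {n m d : ℕ} {S : SOFProblem n m d} {K : Matrix (Fin m) (Fin d) ℝ} {α : ℝ}

/-- The pairing with `X₀` bounds the largest eigenvalue: average the Cauchy–Schwarz inequality
`(xᵀ P y)² ≤ (yᵀ P y) (xᵀ P x)` over the initial state `x`. -/
theorem mu_mul_quadForm_le (hD : MemLp (fun x : Fin n → ℝ => x) 2 S.D) (hX0 : S.X0.PosDef)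
    {P : Matrix (Fin n) (Fin n) ℝ} (hP : P.PosSemidef) (y : Fin n → ℝ) :
    S.mu * (y ⬝ᵥ (P *ᵥ y)) ≤ trace (S.X0 * P) * vnorm y ^ 2 := by
  have htr := trace_X0_nonneg hD (quadForm_nonneg hP)
  rcases (quadForm_nonneg hP y).eq_or_lt with h0 | h0
  · rw [← h0, mul_zero]
    positivity
  have h1 := trace_X0_mono hD (X := vecMulVec (P *ᵥ y) (P *ᵥ y)) (Y := (y ⬝ᵥ (P *ᵥ y)) • P)
    fun x => by
      rw [smul_mulVec, dotProduct_smul, smul_eq_mul]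
      refine le_trans (le_of_eq ?_) (sq_bilinForm_le hP x y)
      rw [vecMulVec_mulVec]
      simp [dotProduct_comm, sq]
  rw [mul_vecMulVec, trace_vecMulVec, Matrix.mul_smul, trace_smul, smul_eq_mul,
    dotProduct_comm] at h1
  have h2 := sigmaMin_mul_sq_le hX0 (P *ᵥ y)
  have h3 : (y ⬝ᵥ (P *ᵥ y)) ^ 2 ≤ vnorm y ^ 2 * vnorm (P *ᵥ y) ^ 2 := by
    rw [← mul_pow]
    exact sq_le_sq' (by linarith [mul_nonneg (vnorm_nonneg y) (vnorm_nonneg (P *ᵥ y))])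
      ((le_abs_self _).trans (abs_dotProduct_le _ _))
  have h4 : 0 ≤ S.mu := sigmaMin_nonneg _
  refine le_of_mul_le_mul_left ?_ h0
  calc y ⬝ᵥ (P *ᵥ y) * (S.mu * (y ⬝ᵥ (P *ᵥ y))) = S.mu * (y ⬝ᵥ (P *ᵥ y)) ^ 2 := by ring
    _ ≤ S.mu * (vnorm y ^ 2 * vnorm (P *ᵥ y) ^ 2) := by gcongr
    _ = vnorm y ^ 2 * (sigmaMin S.X0 * vnorm (P *ᵥ y) ^ 2) := by rw [mu]; ring
    _ ≤ vnorm y ^ 2 * (y ⬝ᵥ (P *ᵥ y) * trace (S.X0 * P)) := by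
        exact mul_le_mul_of_nonneg_left (h2.trans h1) (sq_nonneg _)
    _ = _ := by ring

theorem mu_pos (hn : 0 < n) (hX0 : S.X0.PosDef) : 0 < S.mu := sigmaMin_pos hn hX0

theorem value_le_of_mem_sublevel (hn : 0 < n) (hD : MemLp (fun x : Fin n → ℝ => x) 2 S.D)
    (hX0 : S.X0.PosDef) (hQ : S.Q.PosDef) (hR : S.R.PosDef) (hK : K ∈ S.sublevel α)
    (x : Fin n → ℝ) : x ⬝ᵥ (S.value K *ᵥ x) ≤ α / S.mu * vnorm x ^ 2 := by
  have hst := S.mem_feasible_iff.1 hK.1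
  have h1 := mu_mul_quadForm_le hD hX0 (value_posSemidef hQ hR hst) x
  rw [← cost_eq_trace hD hQ hR hst] at h1
  rw [div_mul_eq_mul_div, le_div_iff₀ (mu_pos hn hX0), mul_comm]
  exact h1.trans (mul_le_mul_of_nonneg_right hK.2 (sq_nonneg _))

/-- The pairs of a feedback matrix `F` on the state, of the form `K C`, and a semidefinite solution
`P` of the Lyapunov equation of the closed loop `A - B F` with `tr (X₀ P) ≤ α`. By Lyapunov's
theorem they are the pairs `(K C, P)` for `K` in the sublevel set, but, unlike stability,
the conditions are visibly closed. -/
def certificates (S : SOFProblem n m d) (α : ℝ) :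
    Set (Matrix (Fin m) (Fin n) ℝ × Matrix (Fin n) (Fin n) ℝ) :=
  {p | p.1 ∈ LinearMap.range (mulRightLinearMap (Fin m) ℝ S.C) ∧
    p.2 = (S.A - S.B * p.1)ᵀ * p.2 * (S.A - S.B * p.1) + (S.Q + p.1ᵀ * S.R * p.1) ∧
    (∀ x, 0 ≤ x ⬝ᵥ (p.2 *ᵥ x)) ∧ trace (S.X0 * p.2) ≤ α}

theorem isClosed_certificates : IsClosed (S.certificates α) := by
  have h1 : Continuous fun p : Matrix (Fin m) (Fin n) ℝ × Matrix (Fin n) (Fin n) ℝ =>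
      S.A - S.B * p.1 := continuous_const.sub (continuous_const.matrix_mul continuous_fst)
  refine IsClosed.inter ?_ (IsClosed.inter ?_ (IsClosed.inter ?_ ?_))
  · exact (Submodule.closed_of_finiteDimensional _).preimage continuous_fst
  · exact isClosed_eq continuous_snd (((h1.matrix_transpose.matrix_mul continuous_snd).matrix_mul
      h1).add (continuous_const.add ((continuous_fst.matrix_transpose.matrix_mul
      continuous_const).matrix_mul continuous_fst)))
  · change IsClosed {p : Matrix (Fin m) (Fin n) ℝ × Matrix (Fin n) (Fin n) ℝ |
      ∀ x, 0 ≤ x ⬝ᵥ (p.2 *ᵥ x)}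
    simp only [Set.ofPred_forall]
    exact isClosed_iInter fun x => isClosed_le continuous_const
      (continuous_const.dotProduct (continuous_snd.matrix_mulVec continuous_const))
  · exact isClosed_le (S.traceX0.continuous.comp continuous_snd) continuous_const

theorem mem_certificates_iff (hn : 0 < n) (hD : MemLp (fun x : Fin n → ℝ => x) 2 S.D)
    (hQ : S.Q.PosDef) (hR : S.R.PosDef)
    {p : Matrix (Fin m) (Fin n) ℝ × Matrix (Fin n) (Fin n) ℝ} :
    p ∈ S.certificates α ↔ ∃ K ∈ S.sublevel α, p = (K * S.C, S.value K) := by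
  constructor
  · rintro ⟨⟨K, hK⟩, heq, hnn, htr⟩
    obtain ⟨F, P⟩ := p
    change K * S.C = F at hK
    subst hK
    have hA : S.A - S.B * (K * S.C) = S.closedLoop K := by rw [closedLoop, Matrix.mul_assoc]
    simp only [hA] at heq hnn htr
    have hst : PowStable (S.closedLoop K) := by
      refine powStable_of_lyapunov heq hnn (sigmaMin_pos hn hQ) fun x => ?_
      have := quadForm_stageWeight S K x
      rw [stageWeight] at this
      rw [this]
      linarith [sigmaMin_mul_sq_le hQ x, quadForm_nonneg hR.posSemidef ((K * S.C) *ᵥ x)]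
    have hP : S.value K = P := hst.lyap_unique heq
    subst hP
    exact ⟨K, ⟨S.mem_feasible_iff.2 hst, by rwa [cost_eq_trace hD hQ hR hst]⟩, rfl⟩
  · rintro ⟨K, hK, rfl⟩
    have hst := S.mem_feasible_iff.1 hK.1
    have hA : S.A - S.B * (K * S.C) = S.closedLoop K := by rw [closedLoop, Matrix.mul_assoc]
    refine ⟨⟨K, rfl⟩, ?_, (quadForm_nonneg (value_posSemidef hQ hR hst)), ?_⟩
    · simp only [hA]
      exact hst.lyap_eq _
    · have := hK.2
      rwa [cost_eq_trace hD hQ hR hst] at this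

theorem isCompact_certificates (hn : 0 < n) (hD : MemLp (fun x : Fin n → ℝ => x) 2 S.D)
    (hX0 : S.X0.PosDef) (hQ : S.Q.PosDef) (hR : S.R.PosDef) : IsCompact (S.certificates α) := by
  refine ((isCompact_matrix_box (α / S.mu / sigmaMin S.R + 1)).prod
    (isCompact_matrix_box (α / S.mu))).of_isClosed_subset isClosed_certificates ?_
  intro p hp
  obtain ⟨K, hK, rfl⟩ := (mem_certificates_iff hn hD hQ hR).1 hp
  have hst := S.mem_feasible_iff.1 hK.1
  have hP := value_posSemidef hQ hR hst
  have hle := value_le_of_mem_sublevel hn hD hX0 hQ hR hK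
  refine ⟨fun i j => ?_, fun i j => ?_⟩
  · refine (abs_entry_le _ _ _).trans ?_
    set y := (K * S.C) *ᵥ Pi.single j 1 with hy
    have h1 := sigmaMin_mul_sq_le hR y
    have h2 := hle (Pi.single j 1)
    have h3 := hst.lyap_quadForm (S.stageWeight K) (Pi.single j 1)
    have h4 := quadForm_nonneg hP (S.closedLoop K *ᵥ Pi.single j 1)
    have h5 := quadForm_nonneg hQ.posSemidef (Pi.single j 1)
    rw [quadForm_stageWeight, ← hy] at h3
    rw [vnorm_single] at h2
    rw [value] at h2 h4
    have h6 : vnorm y ^ 2 ≤ α / S.mu / sigmaMin S.R := by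
      rw [le_div_iff₀ (sigmaMin_pos i.pos hR)]
      linarith
    nlinarith [sq_nonneg (vnorm y - 1)]
  · have h := abs_bilinForm_le (transpose_eq_of_posSemidef hP) (fun x => by
      rw [abs_of_nonneg (quadForm_nonneg hP x)]
      exact hle x) (Pi.single i 1) (Pi.single j 1)
    rw [vnorm_single, vnorm_single] at h
    simpa using h

/-- The maximum of the closed-loop norm over a nonempty sublevel set is attained. -/
theorem isGreatest_gam (hD : MemLp (fun x : Fin n → ℝ => x) 2 S.D) (hX0 : S.X0.PosDef)
    (hQ : S.Q.PosDef) (hR : S.R.PosDef) (hK : K ∈ S.sublevel α) :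
    IsGreatest ((fun L => specNorm (S.closedLoop L)) '' S.sublevel α) (S.gam α) := by
  have hne : ((fun L => specNorm (S.closedLoop L)) '' S.sublevel α).Nonempty := ⟨_, K, hK, rfl⟩
  rcases n.eq_zero_or_pos with rfl | hn
  · have : (fun L => specNorm (S.closedLoop L)) '' S.sublevel α =
        {specNorm (S.closedLoop K)} := by
      refine Set.Subset.antisymm ?_ (Set.singleton_subset_iff.2 ⟨K, hK, rfl⟩)
      rintro _ ⟨L, -, rfl⟩
      rw [Set.mem_singleton_iff]
      exact congrArg specNorm (Subsingleton.elim _ _)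
    rw [gam, this, csSup_singleton]
    exact isGreatest_singleton
  · have himg : (fun L => specNorm (S.closedLoop L)) '' S.sublevel α =
        (fun p : Matrix (Fin m) (Fin n) ℝ × Matrix (Fin n) (Fin n) ℝ =>
          specNorm (S.A - S.B * p.1)) '' S.certificates α := by
      ext t
      constructor
      · rintro ⟨L, hL, rfl⟩
        refine ⟨_, (mem_certificates_iff hn hD hQ hR).2 ⟨L, hL, rfl⟩, ?_⟩
        simp only [closedLoop, Matrix.mul_assoc]
      · rintro ⟨p, hp, rfl⟩
        obtain ⟨L, hL, rfl⟩ := (mem_certificates_iff hn hD hQ hR).1 hp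
        refine ⟨L, hL, ?_⟩
        simp only [closedLoop, Matrix.mul_assoc]
    have hc : IsCompact ((fun L => specNorm (S.closedLoop L)) '' S.sublevel α) := by
      rw [himg]
      exact (isCompact_certificates hn hD hX0 hQ hR).image (continuous_specNorm.comp
        (continuous_const.sub (continuous_const.matrix_mul continuous_fst)))
    exact hc.isGreatest_sSup hne

theorem gainBounds_of_mem_sublevel (hn : 0 < n) (hD : MemLp (fun x : Fin n → ℝ => x) 2 S.D)
    (hX0 : S.X0.PosDef) (hQ : S.Q.PosDef) (hR : S.R.PosDef) (hK : K ∈ S.sublevel α) :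
    S.GainBounds K (α / S.mu) (S.gam α) where
  n_pos := hn
  Q_posDef := hQ
  R_posDef := hR
  stable := S.mem_feasible_iff.1 hK.1
  value_le := value_le_of_mem_sublevel hn hD hX0 hQ hR hK
  loop_le x := (vnorm_mulVec_le _ x).trans (mul_le_mul_of_nonneg_right
    ((isGreatest_gam hD hX0 hQ hR hK).2 ⟨K, hK, rfl⟩) (vnorm_nonneg x))

/-! ### The Lipschitz constant -/

theorem sqrt_le_psi_mul (hn : 0 < n) (hm : 0 < m) (hX0 : S.X0.PosDef) (hR : S.R.PosDef)
    (hα : 0 ≤ α) :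
    √(specNorm S.R * (α / S.mu) + (specNorm S.B * (α / S.mu)) ^ 2) ≤
      S.psi α * specNorm S.R := by
  have hμ := mu_pos hn hX0
  have hσ := sigmaMin_pos hm hR
  have hσR := sigmaMin_le_specNorm hm S.R
  have hA := specNorm_nonneg S.A
  have hB := specNorm_nonneg S.B
  have hr : 0 < specNorm S.R := hσ.trans_le hσR
  have e : √(specNorm S.R * (α / S.mu) + (specNorm S.B * (α / S.mu)) ^ 2) =
      √(specNorm S.R * α + specNorm S.B ^ 2 * α ^ 2 / S.mu) / √S.mu := by
    rw [← Real.sqrt_div' _ hμ.le]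
    congr 1
    field_simp
  have h2 : 0 ≤ specNorm S.B * specNorm S.A * α / (S.mu * sigmaMin S.R) := by positivity
  rw [e, psi, add_mul]
  set w := √(specNorm S.R * α + specNorm S.B ^ 2 * α ^ 2 / S.mu)
  have h3 : w / √S.mu ≤ w / (√S.mu * sigmaMin S.R) * specNorm S.R := by
    have : w / (√S.mu * sigmaMin S.R) * specNorm S.R =
        w / √S.mu * (specNorm S.R / sigmaMin S.R) := by ring
    rw [this]
    exact le_mul_of_one_le_right (by positivity) ((one_le_div hσ).2 hσR)
  linarith [mul_nonneg h2 hr.le]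

/-- The parameter `ζ₂` exceeds the growth rate of the value matrix by a factor `3 / 2`. The
margin comes from `ψ`, and it pays for the cross terms of the third derivative. -/
theorem valueRate_le_zeta2 (hm : 0 < m) (hX0 : S.X0.PosDef) (hα : 0 ≤ α)
    (hb : S.GainBounds K (α / S.mu) (S.gam α)) :
    3 / 2 * S.valueRate (α / S.mu) (S.gam α) ≤ S.zeta2 α := by
  have hq := hb.sigmaMin_Q_pos
  have hp := hb.p_pos
  have hqp := hb.sigmaMin_Q_le
  have hg := hb.loop_nonneg
  have hB := specNorm_nonneg S.B
  have hC := specNorm_nonneg S.C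
  have hr := specNorm_nonneg S.R
  have hψ := sqrt_le_psi_mul hb.n_pos hm hX0 hb.R_posDef hα
  have hζ : S.valueRate (α / S.mu) (S.gam α) ≤ _ := min_le_right _ _
  rw [zeta2, show α * S.gam α / S.mu = α / S.mu * S.gam α by ring]
  set p := α / S.mu
  set g := S.gam α
  set q := sigmaMin S.Q
  set b := specNorm S.B
  set c := specNorm S.C
  set r := specNorm S.R
  have hκ : 1 ≤ p / q := (one_le_div hq).2 hqp
  set w := √(r * p + (b * p) ^ 2)
  have hw : w ^ 2 = r * p + (b * p) ^ 2 := Real.sq_sqrt (by positivity)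
  set v := √(r * c ^ 2 / q)
  have hv : v ^ 2 = r * c ^ 2 / q := Real.sq_sqrt (by positivity)
  have hv0 : 0 ≤ v := Real.sqrt_nonneg _
  have hw0 : 0 ≤ w := Real.sqrt_nonneg _
  have key : p / q * (b * c) + 3 / 2 * v ≤ 2 * (c / q * w) := by
    refine abs_le_of_sq_le_sq' ?_ (by positivity) |>.2
    have e1 : (2 * (c / q * w)) ^ 2 = 4 * ((p / q * (b * c)) ^ 2 + p / q * v ^ 2) := by
      rw [mul_pow, mul_pow, hw, hv]
      field_simp
      ring
    rw [e1]
    nlinarith [mul_le_mul_of_nonneg_right hκ (sq_nonneg v),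
      sq_nonneg (3 / 2 * (p / q * (b * c)) - v), sq_nonneg (p / q * (b * c))]
  have h1 : 2 * (c / q * w) ≤ 2 * c / q * (S.psi α * r) := by
    have := mul_le_mul_of_nonneg_left hψ (show 0 ≤ 2 * (c / q) by positivity)
    linarith [show 2 * c / q * (S.psi α * r) = 2 * (c / q) * (S.psi α * r) by ring]
  have h2 : 0 ≤ p / q * (b * c) := by positivity
  have h3 := mul_le_mul_of_nonneg_left (min_le_left 1 g) h2
  have h4 := mul_le_mul_of_nonneg_left (min_le_right 1 g) h2
  have e2 : 2 * c / q * (p * g * b + S.psi α * r) =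
      2 * (p / q * (b * c) * g) + 2 * c / q * (S.psi α * r) := by ring
  rw [e2]
  linarith

theorem third_derivative_rate_le (hm : 0 < m) (hX0 : S.X0.PosDef) (hα : 0 ≤ α)
    (hb : S.GainBounds K (α / S.mu) (S.gam α)) :
    6 * (specNorm S.B * specNorm S.C) ^ 2 * (S.valueRate (α / S.mu) (S.gam α) * (α / S.mu)) +
        6 * (specNorm S.B * specNorm S.C) * S.valueRate₂ (α / S.mu) (S.gam α) ≤
      4 * (α / S.mu) * (((S.zeta1 α + S.zeta2 α / 2) * specNorm S.B * specNorm S.C +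
        S.zeta3 α + S.zeta4 α / 2) * specNorm S.B * specNorm S.C) := by
  have hζ2 := valueRate_le_zeta2 hm hX0 hα hb
  have hζ1 : S.valueRate (α / S.mu) (S.gam α) ≤ S.zeta1 α := min_le_left _ _
  have hq := hb.sigmaMin_Q_pos
  have hp := hb.p_pos
  have hg := hb.loop_nonneg
  have hB := specNorm_nonneg S.B
  have hC := specNorm_nonneg S.C
  have hζ := hb.valueRate_nonneg
  rw [valueRate₂, zeta3, zeta4]
  generalize S.valueRate (α / S.mu) (S.gam α) = ζ at *
  generalize S.zeta1 α = ζ₁ at *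
  generalize S.zeta2 α = ζ₂ at *
  generalize α / S.mu = p at *
  generalize S.gam α = g at *
  generalize sigmaMin S.Q = q at *
  generalize specNorm S.B = b at *
  generalize specNorm S.C = c at *
  generalize specNorm S.R = r
  have h1 : 0 ≤ p * (b * c) ^ 2 * (4 * ζ₁ + 2 * ζ₂ - 6 * ζ) :=
    mul_nonneg (by positivity) (by linarith)
  have h2 : 0 ≤ p * (b * c) ^ 2 * (p / q) * g * (12 * ζ₁ + 8 * ζ₂ - 24 * ζ) :=
    mul_nonneg (by positivity) (by linarith)
  rw [← sub_nonneg]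
  refine le_trans (add_nonneg h1 h2) (le_of_eq ?_)
  ring

end SOFProblem

namespace SOFProblem

variable {n m d : ℕ} {S : SOFProblem n m d} {K K' : Matrix (Fin m) (Fin d) ℝ} {α : ℝ}

/-! ### Lipschitz continuity of the Hessian -/

theorem cost_nonneg (hQ : S.Q.PosDef) (hR : S.R.PosDef) : 0 ≤ S.cost K :=
  integral_nonneg fun x => tsum_nonneg fun t => by
    rw [stageCost_eq]
    exact stageWeight_quadForm_nonneg hQ hR _

theorem frobNorm_gainOfVec_sq (v : Fin d × Fin m → ℝ) :
    frobNorm (gainOfVec m d v) ^ 2 = ∑ p, v p ^ 2 := by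
  rw [frobNorm_sq, Fintype.sum_prod_type_right]
  rfl

theorem frobNorm_gainOfVec_single (q : Fin d × Fin m) :
    frobNorm (gainOfVec m d (Pi.single q 1)) = 1 := by
  have h : frobNorm (gainOfVec m d (Pi.single q 1)) ^ 2 = 1 := by
    rw [frobNorm_gainOfVec_sq]
    simp [Pi.single_apply]
  nlinarith [frobNorm_nonneg (gainOfVec m d (Pi.single q 1))]

theorem frobNorm_pos {a b : ℕ} {M : Matrix (Fin a) (Fin b) ℝ} (hM : M ≠ 0) : 0 < frobNorm M := by
  refine (frobNorm_nonneg M).lt_of_ne fun h => hM ?_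
  have h0 : specNorm M = 0 :=
    le_antisymm (h ▸ specNorm_le_frobNorm M) (specNorm_nonneg M)
  exact norm_eq_zero.1 (specNorm_eq_norm M ▸ h0)

theorem hessian_apply (p q : Fin d × Fin m) :
    S.hessian K p q = fderiv ℝ (fderiv ℝ S.costVec) (vec K) (Pi.single p 1) (Pi.single q 1) := by
  rw [hessian, of_apply, iteratedFDeriv_two_apply]
  simp

/-- The mean value inequality for the second derivative of the cost along a segment of a sublevel
set. -/
theorem abs_second_derivative_sub_le (hn : 0 < n) (hm : 0 < m)
    (hD : MemLp (fun x : Fin n → ℝ => x) 2 S.D) (hX0 : S.X0.PosDef) (hQ : S.Q.PosDef)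
    (hR : S.R.PosDef) (hseg : ∀ δ ∈ Set.Icc (0 : ℝ) 1, (1 - δ) • K + δ • K' ∈ S.sublevel α)
    {Z Y : Matrix (Fin m) (Fin d) ℝ} (hZ : Z ≠ 0) (hY : Y ≠ 0) (hKK' : K ≠ K') :
    |S.traceX0 (S.value₂ K' Y Z) - S.traceX0 (S.value₂ K Y Z)| ≤
      frobNorm Y * frobNorm Z * frobNorm (K' - K) *
        (4 * (α / S.mu) * (((S.zeta1 α + S.zeta2 α / 2) * specNorm S.B * specNorm S.C +
          S.zeta3 α + S.zeta4 α / 2) * specNorm S.B * specNorm S.C) * (α / sigmaMin S.Q)) := by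
  set L := frobNorm Y * frobNorm Z * frobNorm (K' - K) *
        (4 * (α / S.mu) * (((S.zeta1 α + S.zeta2 α / 2) * specNorm S.B * specNorm S.C +
          S.zeta3 α + S.zeta4 α / 2) * specNorm S.B * specNorm S.C) * (α / sigmaMin S.Q)) with hL
  have hline : ∀ t : ℝ, K + t • (K' - K) = (1 - t) • K + t • K' := fun t => by module
  have hmem : ∀ t ∈ Set.Icc (0 : ℝ) 1, K + t • (K' - K) ∈ S.sublevel α := fun t ht => by
    rw [hline]
    exact hseg t ht
  have hderiv : ∀ t ∈ Set.Icc (0 : ℝ) 1,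
      HasDerivWithinAt (fun t : ℝ => S.traceX0 (S.value₂ (K + t • (K' - K)) Y Z))
        (S.traceX0 (S.value₃ (K + t • (K' - K)) Y Z (K' - K))) (Set.Icc 0 1) t := fun t ht =>
    (S.traceX0.hasFDerivAt.comp_hasDerivAt t
      (hasDerivAt_value₂ (S.mem_feasible_iff.1 (hmem t ht).1))).hasDerivWithinAt
  have hbound : ∀ t ∈ Set.Icc (0 : ℝ) 1,
      ‖S.traceX0 (S.value₃ (K + t • (K' - K)) Y Z (K' - K))‖ ≤ L := by
    intro t ht
    have hb := gainBounds_of_mem_sublevel hn hD hX0 hQ hR (hmem t ht)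
    have hq := hb.sigmaMin_Q_pos
    have hα : 0 ≤ α := (cost_nonneg hQ hR).trans (hmem t ht).2
    have h1 := hb.abs_traceX0_value₃_le hD (frobNorm_pos hY) (specNorm_le_frobNorm Y)
      (frobNorm_pos hZ) (specNorm_le_frobNorm Z) (frobNorm_pos (sub_ne_zero.2 hKK'.symm))
      (specNorm_le_frobNorm (K' - K))
    have h2 := third_derivative_rate_le hm hX0 hα hb
    have h3 : S.traceX0 (S.value (K + t • (K' - K))) ≤ α := by
      rw [traceX0_apply, ← cost_eq_trace hD hQ hR hb.stable]
      exact (hmem t ht).2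
    have h4 : 0 ≤ 6 * (specNorm S.B * specNorm S.C) ^ 2 *
        (S.valueRate (α / S.mu) (S.gam α) * (α / S.mu)) +
        6 * (specNorm S.B * specNorm S.C) * S.valueRate₂ (α / S.mu) (S.gam α) := by
      have := hb.valueRate_nonneg
      have := hb.valueRate₂_nonneg
      have := hb.p_pos
      have := specNorm_nonneg S.B
      have := specNorm_nonneg S.C
      positivity
    have h5 : 0 ≤ frobNorm Y * frobNorm Z * frobNorm (K' - K) :=
      mul_nonneg (mul_nonneg (frobNorm_nonneg _) (frobNorm_nonneg _)) (frobNorm_nonneg _)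
    rw [Real.norm_eq_abs, hL, ← mul_assoc]
    refine h1.trans (mul_le_mul (mul_le_mul_of_nonneg_left h2 h5)
      (div_le_div_of_nonneg_right h3 hq.le) ?_ (mul_nonneg h5 (h4.trans h2)))
    exact div_nonneg (trace_X0_nonneg hD hb.value_nonneg) hq.le
  have h := (convex_Icc (0 : ℝ) 1).norm_image_sub_le_of_norm_hasDerivWithin_le hderiv hbound
    (Set.left_mem_Icc.2 zero_le_one) (Set.right_mem_Icc.2 zero_le_one)
  simpa using h

/-- If every column `v` of `G` satisfies `|v|² ≤ |v| L`, which is what testing the bilinear form of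
`G` against `v` and a coordinate vector gives, then each column has norm at most `L`. -/
theorem frobNorm_le_of_columns {ι : Type*} [Fintype ι] {G : Matrix ι ι ℝ} {L : ℝ} (hL : 0 ≤ L)
    (h : ∀ q, ∑ p, G p q ^ 2 ≤ √(∑ p, G p q ^ 2) * L) :
    frobNorm G ≤ √(Fintype.card ι) * L := by
  have hcol : ∀ q, ∑ p, G p q ^ 2 ≤ L ^ 2 := by
    intro q
    have h0 : 0 ≤ ∑ p, G p q ^ 2 := by positivity
    have h1 := Real.sq_sqrt h0
    have h2 := h q
    have h3 := Real.sqrt_nonneg (∑ p, G p q ^ 2)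
    nlinarith [sq_nonneg (√(∑ p, G p q ^ 2) - L)]
  rw [frobNorm, ← Real.sqrt_sq hL, ← Real.sqrt_mul (Nat.cast_nonneg _), Finset.sum_comm]
  refine Real.sqrt_le_sqrt ((Finset.sum_le_sum fun q _ => hcol q).trans (le_of_eq ?_))
  simp

theorem frobNorm_hessian_sub_le (hn : 0 < n) (hD : MemLp (fun x : Fin n → ℝ => x) 2 S.D)
    (hX0 : S.X0.PosDef) (hQ : S.Q.PosDef) (hR : S.R.PosDef)
    (hseg : ∀ δ ∈ Set.Icc (0 : ℝ) 1, (1 - δ) • K + δ • K' ∈ S.sublevel α) (hKK' : K ≠ K') :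
    frobNorm (S.hessian K' - S.hessian K) ≤ S.lipConst α * frobNorm (K' - K) := by
  have hm : 0 < m := by
    rcases m.eq_zero_or_pos with rfl | h
    · exact absurd (Subsingleton.elim K K') hKK'
    · exact h
  have hK : K ∈ S.sublevel α := by simpa using hseg 0 (by simp)
  have hK' : K' ∈ S.sublevel α := by simpa using hseg 1 (by simp)
  have hb := gainBounds_of_mem_sublevel hn hD hX0 hQ hR hK
  have hb' := gainBounds_of_mem_sublevel hn hD hX0 hQ hR hK'
  have hα : 0 ≤ α := (cost_nonneg hQ hR).trans hK.2
  set M₀ := 4 * (α / S.mu) * (((S.zeta1 α + S.zeta2 α / 2) * specNorm S.B * specNorm S.C +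
    S.zeta3 α + S.zeta4 α / 2) * specNorm S.B * specNorm S.C) * (α / sigmaMin S.Q) with hM₀
  have hM₀0 : 0 ≤ M₀ := by
    refine mul_nonneg (le_trans ?_ (third_derivative_rate_le hm hX0 hα hb))
      (div_nonneg hα hb.sigmaMin_Q_pos.le)
    have := hb.valueRate_nonneg
    have := hb.valueRate₂_nonneg
    have := hb.p_pos
    have := specNorm_nonneg S.B
    have := specNorm_nonneg S.C
    positivity
  have hcol : ∀ q, ∑ p, (S.hessian K' - S.hessian K) p q ^ 2 ≤
      √(∑ p, (S.hessian K' - S.hessian K) p q ^ 2) * (frobNorm (K' - K) * M₀) := by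
    intro q
    -- test the difference of the Hessians against its own column `q`
    set v : Fin d × Fin m → ℝ := fun p => (S.hessian K' - S.hessian K) p q with hv
    have hexp : ∀ T : (Fin d × Fin m → ℝ) →L[ℝ] (Fin d × Fin m → ℝ) →L[ℝ] ℝ,
        T v (Pi.single q 1) = ∑ p, v p * T (Pi.single p 1) (Pi.single q 1) := by
      intro T
      conv_lhs => rw [pi_eq_sum_univ' v]
      simp
    have hsum : ∑ p, v p ^ 2 =
        fderiv ℝ (fderiv ℝ S.costVec) (vec K') v (Pi.single q 1) -
          fderiv ℝ (fderiv ℝ S.costVec) (vec K) v (Pi.single q 1) := by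
      rw [hexp, hexp, ← Finset.sum_sub_distrib]
      refine Finset.sum_congr rfl fun p _ => ?_
      rw [← hessian_apply, ← hessian_apply, ← mul_sub, sq]
      rfl
    change ∑ p, v p ^ 2 ≤ √(∑ p, v p ^ 2) * (frobNorm (K' - K) * M₀)
    rcases eq_or_ne v 0 with h0 | h0
    · simp [h0]
    have hZ : gainOfVec m d v ≠ 0 := fun h => h0 (by
      rw [← vec_gainOfVec v, h]
      rfl)
    have hY : gainOfVec m d (Pi.single q 1) ≠ 0 := fun h => by
      have := frobNorm_gainOfVec_single q
      rw [h] at this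
      simp [frobNorm] at this
    have h1 := abs_second_derivative_sub_le hn hm hD hX0 hQ hR hseg hZ hY hKK'
    rw [frobNorm_gainOfVec_single, one_mul, ← hM₀] at h1
    have h2 : frobNorm (gainOfVec m d v) = √(∑ p, v p ^ 2) := by
      rw [← frobNorm_gainOfVec_sq, Real.sqrt_sq (frobNorm_nonneg _)]
    rw [h2] at h1
    have h3 := fderiv_fderiv_costVec hD hQ hR (v := vec K) hb.stable v (Pi.single q 1)
    have h4 := fderiv_fderiv_costVec hD hQ hR (v := vec K') hb'.stable v (Pi.single q 1)
    rw [gainOfVec_vec] at h3 h4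
    rw [← h3, ← h4, ← hsum] at h1
    rw [← mul_assoc]
    exact (le_abs_self _).trans h1
  refine (frobNorm_le_of_columns (mul_nonneg (frobNorm_nonneg _) hM₀0) hcol).trans (le_of_eq ?_)
  rw [lipConst, hM₀, Fintype.card_prod, Fintype.card_fin, Fintype.card_fin, Nat.cast_mul,
    mul_comm (d : ℝ)]
  ring

/-- Without states the cost vanishes identically. -/
theorem costVec_eq_zero (S : SOFProblem 0 m d) : S.costVec = 0 := by
  ext v
  have h : ∀ (K : Matrix (Fin m) (Fin d) ℝ) x t, S.stageCost K x t = 0 := fun K x t => by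
    rw [stageCost_eq]
    exact Finset.sum_empty
  simp [costVec, cost, h]

end SOFProblem

theorem lemma7 {n m d : ℕ} (S : SOFProblem n m d) [IsProbabilityMeasure S.D]
    (hD : MemLp (fun x : Fin n → ℝ => x) 2 S.D) (hX0 : S.X0.PosDef)
    (hQ : S.Q.PosDef) (hR : S.R.PosDef) (α : ℝ)
    (K K' : Matrix (Fin m) (Fin d) ℝ)
    (hK : K ∈ S.sublevel α) (hK' : K' ∈ S.sublevel α)
    (hseg : ∀ δ ∈ Set.Icc (0 : ℝ) 1, (1 - δ) • K + δ • K' ∈ S.sublevel α) :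
    IsGreatest ((fun L => specNorm (S.closedLoop L)) '' S.sublevel α) (S.gam α) ∧
    ContDiffAt ℝ 2 S.costVec (vec K) ∧ ContDiffAt ℝ 2 S.costVec (vec K') ∧
    frobNorm (S.hessian K' - S.hessian K) ≤ S.lipConst α * frobNorm (K' - K) := by
  refine ⟨SOFProblem.isGreatest_gam hD hX0 hQ hR hK,
    (SOFProblem.contDiffAt_costVec (v := vec K) hD hQ hR
      (S.mem_feasible_iff.1 hK.1)).of_le le_top,
    (SOFProblem.contDiffAt_costVec (v := vec K') hD hQ hR
      (S.mem_feasible_iff.1 hK'.1)).of_le le_top, ?_⟩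
  rcases eq_or_ne K K' with rfl | hne
  · simp [frobNorm]
  rcases n.eq_zero_or_pos with rfl | hn
  · have hB : specNorm S.B = 0 := by
      refine le_antisymm (specNorm_le S.B le_rfl fun x => le_of_eq ?_) (specNorm_nonneg S.B)
      have h0 : S.B *ᵥ x = 0 := funext fun i => i.elim0
      rw [h0, vnorm_zero, zero_mul]
    simp [SOFProblem.hessian, S.costVec_eq_zero, SOFProblem.lipConst, hB, frobNorm]
  · exact SOFProblem.frobNorm_hessian_sub_le hn hD hX0 hQ hR hseg hne

end
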